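/- Let $r\ge 5$ and $n>6r\binom{4r}{r-1}$ be integers. An $r$-uniform Berge-cycle of length $n$ consists of $n$ distinct vertices $v_1,\dots,v_n$ and $n$ distinct $r$-element edges $e_1,\dots,e_n$ such that $\{v_i,v_{i+1}\}\subseteq e_i$ for every $i$ (indices modulo $n$); a Berge-cycle in a hypergraph is Hamiltonian if its length equals the number of vertices of the hypergraph. Then every coloring of the edges of the complete $r$-uniform hypergraph $K_n^r$ on $n$ vertices with $r-1$ colors contains a Hamiltonian Berge-cycle all of whose edges have the same color. Consequently $R_{r-1}(C_n^r)=n$, where $R_{r-1}(C_n^r)$ denotes the least $N$ such that every $(r-1)$-coloring of the edges of $K_N^r$ contains a monochromatic $r$-uniform Berge-cycle of length $n$. -/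

import Mathlib

/-- The complete `r`-uniform hypergraph on the vertex set `V`: its edges are all `r`-element
subsets of `V`. -/
def completeUniform (V : Type*) (r : ℕ) : Hypergraph V where
  vertexSet := Set.univ
  edgeSet := {e | e.encard = r}
  subset_vertexSet_of_mem_edgeSet' := fun _ _ => Set.subset_univ _

/-- A coloring of the edges of the hypergraph `H` with colors in `K`. -/
abbrev EdgeColoring {V : Type*} (H : Hypergraph V) (K : Type*) : Type _ :=
  H.edgeSet → K

/-- The spanning subhypergraph of `H` formed by all edges of color `k`. -/
def colorClass {V K : Type*} {H : Hypergraph V} (c : EdgeColoring H K) (k : K) :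
    Hypergraph V where
  vertexSet := H.vertexSet
  edgeSet := {e | ∃ h : e ∈ H.edgeSet, c ⟨e, h⟩ = k}
  subset_vertexSet_of_mem_edgeSet' := fun _ he => H.subset_vertexSet_of_mem_edgeSet' he.1

/-- The cyclic successor `i + 1` modulo `n` on `Fin n`. -/
def cyclicSucc {n : ℕ} (i : Fin n) : Fin n :=
  ⟨(i.val + 1) % n, Nat.mod_lt _ i.pos⟩

/-- `v` and `e` form a Berge-cycle of length `n` in the hypergraph `H`: the core vertices `v i`
are distinct, the edges `e i` are distinct edges of `H`, and `e i` contains both `v i` and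
`v (i + 1)`, indices being taken modulo `n`. -/
structure IsBergeCycle {V : Type*} (H : Hypergraph V) {n : ℕ}
    (v : Fin n → V) (e : Fin n → Set V) : Prop where
  core_injective : Function.Injective v
  edge_injective : Function.Injective e
  edge_mem : ∀ i, e i ∈ H.edgeSet
  left_mem : ∀ i, v i ∈ e i
  right_mem : ∀ i, v (cyclicSucc i) ∈ e i

/-- The hypergraph `H` contains a Berge-cycle of length `n`. -/
def HasBergeCycle {V : Type*} (H : Hypergraph V) (n : ℕ) : Prop :=
  ∃ (v : Fin n → V) (e : Fin n → Set V), IsBergeCycle H v e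

/-- The finite hypergraph `H` contains a Hamiltonian Berge-cycle: a Berge-cycle whose length is
the number of vertices of `H`. -/
def HasHamiltonianBergeCycle {V : Type*} [Finite V] (H : Hypergraph V) : Prop :=
  HasBergeCycle H H.vertexSet.ncard

/-- `IsBergeCycleRamseyNumber k r n N` says that `N` is the `k`-color Ramsey number of the
`r`-uniform Berge-cycle of length `n`, that is, the minimum number `N` of vertices such that
every `k`-edge coloring of the complete `r`-uniform hypergraph on `N` vertices contains a
monochromatic Berge-cycle of length `n`. -/
def IsBergeCycleRamseyNumber (k r n N : ℕ) : Prop :=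
  IsLeast {M : ℕ | ∀ c : EdgeColoring (completeUniform (Fin M) r) (Fin k),
    ∃ i : Fin k, HasBergeCycle (colorClass c i) n} N

/-! Suppose that no color has a Hamiltonian Berge-cycle. Call a pair sparse for a color if fewer
than `2 * r` edges of that color contain it; `nbr` lists the sparse partners of a vertex. A set of
at most `r - 1` vertices cannot contain a sparse pair for every color: padded to size `r - 1`, it
extends to an `r`-set in about `n` ways, and each color accounts for at most `2 * r` of them. Colors
having no edge through a given vertex of the set and a generic further vertex are also harmless
(`false_of_one_free`), and with `r - 2` vertices two colors may stay open as long as each has many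
sparse pairs leaving the set (`false_of_two_free`). The aim is to build such a set for `r - 1`
colors, paying roughly one vertex per color.

Sparse pairs abound in a bad color. By Hall's theorem a Hamiltonian cycle of pairs lying in at least
`r` edges each lifts to a Berge-cycle, since an `r`-set serves at most `r` consecutive pairs
(`exists_representatives`). The graph of non-sparse pairs is therefore essentially non-Hamiltonian,
and the closure of Bondy and Chvátal yields Chvátal-type degree conditions for the sparse graph
(`IsChvatal`). Vertices with few non-sparse partners are threaded into the cycle by reserved edges;
this fails only if some vertex meets few others in that color (`IsVoid`) or if there are too many
such vertices (`IsSpread`). This is `color_trichotomy`.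

For the assembly, a void color is paid for by its vertex, and two colors with a common sparse pair
by the two ends of that pair. The remaining colors have almost disjoint sparse neighborhoods. They
are served by a star at a vertex ordinary for all of them, or by a double star on a pair that is
sparse for one of them (`exists_center`); leaving two leaves open meets the budget (`false_of_fan`).
A single remaining color needs separate treatment: `hasHamBerge_of_sunflower` or
`false_of_one_unmatched`. -/

/-! ### Hamiltonian cycles and the Bondy–Chvátal closure. -/

/-- `c` is a Hamiltonian cycle of the relation `R`. -/
structure IsHamCycle {V : Type*} (R : V → V → Prop) (c : Cycle V) : Prop where
  nodup : c.Nodup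
  mem : ∀ v, v ∈ c
  chain : c.Chain R

theorem cycle_chain_iff_getElem {α : Type*} {R : α → α → Prop} (m : List α) :
    Cycle.Chain R (m : Cycle α) ↔
      ∀ i (h : i < m.length), R m[i] (m[(i + 1) % m.length]'(Nat.mod_lt _ (by omega))) := by
  cases m with
  | nil => simp
  | cons a l =>
    rw [Cycle.chain_coe_cons, List.isChain_iff_getElem]
    constructor
    · intro h i hi
      have := h i (by simp at hi ⊢; omega)
      simp only [List.length_cons] at hi
      rcases Nat.lt_or_ge (i + 1) (l.length + 1) with h1 | h1
      · simp only [List.length_cons, Nat.mod_eq_of_lt h1]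
        have e1 : (a :: (l ++ [a]))[i]'(by simp; omega) = (a :: l)[i]'(by simp; omega) := by
          simp only [← List.cons_append]
          rw [List.getElem_append_left]
        have e2 : (a :: (l ++ [a]))[i + 1]'(by simp; omega) = (a :: l)[i + 1]'(by simp; omega) := by
          simp only [← List.cons_append]
          rw [List.getElem_append_left]
        rw [← e1, ← e2]; exact this
      · have hi' : i = l.length := by omega
        subst hi'
        simp only [List.length_cons, Nat.mod_self]
        have e1 : (a :: (l ++ [a]))[l.length]'(by simp) = (a :: l)[l.length] := by
          simp only [← List.cons_append]
          rw [List.getElem_append_left]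
        rw [← e1]; simpa using this
    · intro h i hi
      simp at hi
      have := h i (by simp; omega)
      rcases Nat.lt_or_ge (i + 1) (l.length + 1) with h1 | h1
      · simp only [List.length_cons, Nat.mod_eq_of_lt h1] at this
        have e1 : (a :: (l ++ [a]))[i]'(by simp; omega) = (a :: l)[i]'(by simp; omega) := by
          simp only [← List.cons_append]
          rw [List.getElem_append_left]
        have e2 : (a :: (l ++ [a]))[i + 1]'(by simp; omega) = (a :: l)[i + 1]'(by simp; omega) := by
          simp only [← List.cons_append]
          rw [List.getElem_append_left]
        rw [e1, e2]; exact this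
      · have hi' : i = l.length := by omega
        subst hi'
        simp only [List.length_cons, Nat.mod_self] at this
        have e1 : (a :: (l ++ [a]))[l.length]'(by simp) = (a :: l)[l.length] := by
          simp only [← List.cons_append]
          rw [List.getElem_append_left]
        rw [e1]; simpa using this

/-- A Hamiltonian path whose ends are adjacent closes up to a Hamiltonian cycle. -/
theorem isHamCycle_of_path {V : Type*} {R : V → V → Prop} {l : List V} (hne : l ≠ [])
    (hn : l.Nodup) (hm : ∀ v, v ∈ l) (hc : l.IsChain R) (h : R (l.getLast hne) (l.head hne)) :
    IsHamCycle R (l : Cycle V) := by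
  refine ⟨by simpa using hn, by simpa using hm, ?_⟩
  rw [Cycle.chain_ne_nil _ hne, List.isChain_cons]
  refine ⟨?_, hc⟩
  intro y hy
  rw [List.head?_eq_some_head hne] at hy
  simp at hy; subst hy; exact h

open Classical in
/-- The rotation step in the theorem of Bondy and Chvátal. -/
theorem isHamCycle_of_path_of_card_le {V : Type*} [Fintype V] {G : SimpleGraph V}
    {l : List V} (hne : l ≠ []) (hn : l.Nodup) (hm : ∀ v, v ∈ l) (hc : l.IsChain G.Adj)
    (hd : Fintype.card V ≤ G.degree (l.head hne) + G.degree (l.getLast hne)) :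
    ∃ c, IsHamCycle G.Adj c := by
  have hlen : l.length = Fintype.card V := by
    rw [← List.toFinset_card_of_nodup hn, ← Finset.card_univ]
    congr 1; ext v; simp [hm v]
  have hpos : 0 < l.length := List.length_pos_iff.2 hne
  set u := l.head hne
  set v := l.getLast hne
  have hu : l.idxOf u = 0 := by
    simp [u, List.head_eq_getElem, hn.idxOf_getElem]
  have hv : l.idxOf v = l.length - 1 := by
    simp [v, List.getLast_eq_getElem, hn.idxOf_getElem]
  have idx_inj : ∀ a b, l.idxOf a = l.idxOf b → a = b := fun a b h =>
    (List.idxOf_inj (hm a)).1 h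
  set A := (G.neighborFinset u).image l.idxOf
  -- The shift by one makes a common element `i` of `A` and `B` a crossing: `u` is adjacent to
  -- `l[i]` and `v` to `l[i - 1]`. Both sets lie in the `n - 1` positions from `1` to `n - 1` and
  -- have total size at least `n`, so they meet.
  set B := (G.neighborFinset v).image (fun w => l.idxOf w + 1)
  have hA : A.card = G.degree u := by
    rw [Finset.card_image_of_injective _ (fun a b h => idx_inj a b h)]; rfl
  have hB : B.card = G.degree v := by
    rw [Finset.card_image_of_injective _ (fun a b h => idx_inj a b (by simpa using h))]; rfl
  have hAB : A ∪ B ⊆ Finset.Ico 1 l.length := by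
    intro i hi
    rw [Finset.mem_Ico]
    rcases Finset.mem_union.1 hi with hi | hi
    · obtain ⟨w, hw, rfl⟩ := Finset.mem_image.1 hi
      rw [SimpleGraph.mem_neighborFinset] at hw
      refine ⟨?_, List.idxOf_lt_length_iff.2 (hm w)⟩
      by_contra h
      exact hw.ne (idx_inj _ _ (by omega))
    · obtain ⟨w, hw, rfl⟩ := Finset.mem_image.1 hi
      rw [SimpleGraph.mem_neighborFinset] at hw
      refine ⟨by omega, ?_⟩
      have := List.idxOf_lt_length_iff.2 (hm w)
      by_contra h
      exact hw.ne (idx_inj _ _ (by omega))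
  have hcard := Finset.card_le_card hAB
  have hint : (A ∩ B).Nonempty := by
    rw [← Finset.card_pos]
    have := Finset.card_union_add_card_inter A B
    have hI : (Finset.Ico 1 l.length).card = l.length - 1 := Nat.card_Ico _ _
    omega
  obtain ⟨i, hi⟩ := hint
  rw [Finset.mem_inter] at hi
  obtain ⟨⟨w, hw, hwi⟩, ⟨x, hx, hxi⟩⟩ := And.intro (Finset.mem_image.1 hi.1) (Finset.mem_image.1 hi.2)
  rw [SimpleGraph.mem_neighborFinset] at hw hx
  change l.idxOf x + 1 = i at hxi
  have hil : i < l.length := by rw [← hwi]; exact List.idxOf_lt_length_iff.2 (hm w)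
  have hwl : l[i] = w := by
    have := List.getElem_idxOf (List.idxOf_lt_length_iff.2 (hm w))
    simp only [hwi] at this; exact this
  have hxl : l[i - 1] = x := by
    have := List.getElem_idxOf (List.idxOf_lt_length_iff.2 (hm x))
    have e : l.idxOf x = i - 1 := by omega
    simp only [e] at this; exact this
  have htne : l.take i ≠ [] := by
    intro h; have := congrArg List.length h; simp only [List.length_take, List.length_nil] at this; omega
  have hdne : l.drop i ≠ [] := by
    intro h; have := congrArg List.length h; simp only [List.length_drop, List.length_nil] at this; omega
  -- Reversing the first `i` vertices gives a path from `x` through `u`, `w` to `v`, closed by the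
  -- edge from `v` to `x`.
  refine ⟨((l.take i).reverse ++ l.drop i : List V), isHamCycle_of_path (by simp [hdne]) ?_ ?_ ?_ ?_⟩
  · have : ((l.take i).reverse ++ l.drop i).Perm l := by
      conv_rhs => rw [← List.take_append_drop i l]
      exact List.Perm.append_right _ (List.reverse_perm _)
    exact this.nodup_iff.2 hn
  · intro z
    have := hm z
    rw [← List.take_append_drop i l, List.mem_append] at this
    rw [List.mem_append, List.mem_reverse]; exact this
  · rw [List.isChain_append]
    refine ⟨?_, hc.drop i, ?_⟩
    · rw [List.isChain_reverse]
      exact (hc.take i).imp (fun a b h => h.symm)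
    · intro a ha b hb
      have ha' : a = u := by
        rw [List.getLast?_reverse, List.head?_eq_some_head htne] at ha
        simp only [Option.mem_def, Option.some.injEq] at ha
        rw [← ha, List.head_take]
      have hb' : b = w := by
        rw [List.head?_drop, List.getElem?_eq_getElem hil, hwl] at hb
        simpa using hb.symm
      rw [ha', hb']; exact hw
  · have h1 : ((l.take i).reverse ++ l.drop i).getLast (by simp [hdne]) = v := by
      rw [List.getLast_append_of_right_ne_nil _ _ hdne, List.getLast_drop]
    have h2 : ((l.take i).reverse ++ l.drop i).head (by simp [hdne]) = x := by
      rw [List.head_append_of_ne_nil (by simpa using htne), List.head_reverse,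
        List.getLast_eq_getElem]
      simp only [List.length_take, Nat.min_eq_left hil.le, List.getElem_take]
      exact hxl
    rw [h1, h2]; exact hx

open Classical in
/-- The step of the closure operation of Bondy and Chvátal. -/
theorem isHamCycle_of_sup_edge {V : Type*} [Fintype V] {G : SimpleGraph V} {u v : V}
    (h3 : 3 ≤ Fintype.card V)
    (hd : Fintype.card V ≤ G.degree u + G.degree v) {c : Cycle V}
    (hc : IsHamCycle (G ⊔ SimpleGraph.edge u v).Adj c) : ∃ c, IsHamCycle G.Adj c := by
  by_cases hG : c.Chain G.Adj
  · exact ⟨c, hc.nodup, hc.mem, hG⟩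
  induction c using Quotient.inductionOn' with
  | h m =>
  change ¬ Cycle.Chain G.Adj (m : Cycle V) at hG
  have hnd : m.Nodup := hc.nodup
  have hmem : ∀ v, v ∈ m := hc.mem
  have hch : Cycle.Chain (G ⊔ SimpleGraph.edge u v).Adj (m : Cycle V) := hc.chain
  rw [cycle_chain_iff_getElem] at hG
  push Not at hG
  obtain ⟨i, hi, hadj⟩ := hG
  have hlen : m.length = Fintype.card V := by
    rw [← List.toFinset_card_of_nodup hnd, ← Finset.card_univ]
    congr 1; ext v; simp [hmem v]
  -- Cutting the cycle at a pair that is not in `G` leaves a path whose ends are `u` and `v`. With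
  -- at least three vertices this pair occurs only once on the cycle, so the path lies in `G`.
  set p := m.rotate (i + 1) with hp
  have hpl : p.length = m.length := List.length_rotate _ _
  have hpne : p ≠ [] := by intro h; rw [h] at hpl; simp at hpl; omega
  have hpc : Cycle.Chain (G ⊔ SimpleGraph.edge u v).Adj (p : Cycle V) := by
    have : (p : Cycle V) = m := Cycle.coe_eq_coe.2 (List.IsRotated.symm ⟨i + 1, rfl⟩)
    rw [this]; exact hch
  have hpn : p.Nodup := List.nodup_rotate.2 hnd
  have hpm : ∀ v, v ∈ p := fun v => List.mem_rotate.2 (hmem v)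
  have hhead : p.head hpne = m[(i + 1) % m.length]'(Nat.mod_lt _ (by omega)) := by
    rw [List.head_eq_getElem, List.getElem_rotate]; simp
  have hlast : p.getLast hpne = m[i] := by
    rw [List.getLast_eq_getElem, List.getElem_rotate]
    congr 1
    rw [hpl, show m.length - 1 + (i + 1) = i + m.length by omega, Nat.add_mod_right,
      Nat.mod_eq_of_lt hi]
  have hx := (cycle_chain_iff_getElem _).1 hch i hi
  rw [← hhead, ← hlast] at hx hadj
  rw [SimpleGraph.sup_adj, SimpleGraph.edge_adj] at hx
  have hends : (p.head hpne = u ∧ p.getLast hpne = v) ∨ (p.head hpne = v ∧ p.getLast hpne = u) := by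
    tauto
  have hne' : ∀ (j k : ℕ) (hj : j < p.length) (hk : k < p.length), p[j] = p[k] → j = k :=
    fun j k hj hk h => (hpn.getElem_inj_iff).1 h
  have hpath : p.IsChain G.Adj := by
    rw [List.isChain_iff_getElem]
    intro j hj
    have h1 := (cycle_chain_iff_getElem _).1 hpc j (by omega)
    simp only [Nat.mod_eq_of_lt hj] at h1
    rw [SimpleGraph.sup_adj, SimpleGraph.edge_adj] at h1
    rw [List.head_eq_getElem, List.getLast_eq_getElem] at hends
    rcases h1 with h1 | ⟨h1, -⟩
    · exact h1
    · exfalso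
      have key : (p[j] = p[0]'(by omega) ∧ p[j + 1] = p[p.length - 1]) ∨
          (p[j] = p[p.length - 1] ∧ p[j + 1] = p[0]'(by omega)) := by
        rcases h1 with ⟨a, b⟩ | ⟨a, b⟩ <;> rcases hends with ⟨c, d⟩ | ⟨c, d⟩ <;> simp [a, b, c, d]
      rcases key with ⟨a, b⟩ | ⟨a, b⟩
      · have := hne' _ _ _ _ a
        have := hne' _ _ _ _ b
        omega
      · have := hne' _ _ _ _ b
        omega
  refine isHamCycle_of_path_of_card_le hpne hpn hpm hpath ?_
  rcases hends with ⟨a, b⟩ | ⟨a, b⟩ <;> rw [a, b] <;> omega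

open Classical in
/-- If the non-Hamiltonian graph `Γ` becomes Hamiltonian whenever the complement of `E` is turned
into a clique, some graph between the two is saturated for the closure of Bondy and Chvátal. -/
theorem exists_saturated {V : Type*} [Fintype V] (Γ : SimpleGraph V) (E : Set V)
    (h3 : 3 ≤ Fintype.card V) (hΓ : ¬ ∃ c, IsHamCycle Γ.Adj c)
    (hcl : ∀ G : SimpleGraph V, Γ ≤ G → (∀ u v, u ∉ E → v ∉ E → u ≠ v → G.Adj u v) →
      ∃ c, IsHamCycle G.Adj c) :
    ∃ G : SimpleGraph V, Γ ≤ G ∧ (∀ u v, G.Adj u v → Γ.Adj u v ∨ (u ∉ E ∧ v ∉ E)) ∧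
      (∃ u v, u ∉ E ∧ v ∉ E ∧ u ≠ v ∧ ¬ G.Adj u v) ∧
      ∀ u v, u ∉ E → v ∉ E → u ≠ v → ¬ G.Adj u v → G.degree u + G.degree v < Fintype.card V := by
  let S : Set (SimpleGraph V) := {G | Γ ≤ G ∧ (∀ u v, G.Adj u v → Γ.Adj u v ∨ (u ∉ E ∧ v ∉ E)) ∧
    ¬ ∃ c, IsHamCycle G.Adj c}
  have hS : Γ ∈ S := ⟨le_rfl, fun u v h => Or.inl h, hΓ⟩
  obtain ⟨G, hle, hG⟩ := (Set.toFinite S).exists_le_maximal hS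
  obtain ⟨h1, h2, h4⟩ := hG.prop
  refine ⟨G, h1, h2, ?_, ?_⟩
  · by_contra hcon
    push Not at hcon
    exact h4 (hcl G h1 hcon)
  · intro u v hu hv huv hadj
    by_contra hcon
    push Not at hcon
    have hmem : (G ⊔ SimpleGraph.edge u v) ∈ S := by
      refine ⟨h1.trans le_sup_left, ?_, ?_⟩
      · intro a b hab
        rw [SimpleGraph.sup_adj, SimpleGraph.edge_adj] at hab
        rcases hab with hab | ⟨⟨rfl, rfl⟩ | ⟨rfl, rfl⟩, -⟩
        · exact h2 _ _ hab
        · exact Or.inr ⟨hu, hv⟩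
        · exact Or.inr ⟨hv, hu⟩
      · rintro ⟨c, hc⟩
        exact h4 (isHamCycle_of_sup_edge h3 (by convert hcon) hc)
    have := hG.le_of_ge hmem le_sup_left
    apply hadj
    apply this
    rw [SimpleGraph.sup_adj, SimpleGraph.edge_adj]
    exact Or.inr ⟨Or.inl ⟨rfl, rfl⟩, huv⟩

/-! ### Lifting Hamiltonian cycles of pairs to Berge-cycles by Hall's theorem. -/

section Lifting

variable {V ι : Type*} [Fintype V] [DecidableEq V] [DecidableEq ι]

/-- The `r`-sets of color `i` that contain `x` and `y`. -/
def edgesThrough (χ : Finset V → ι) (r : ℕ) (i : ι) (x y : V) : Finset (Finset V) :=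
  Finset.univ.filter fun e => e.card = r ∧ χ e = i ∧ x ∈ e ∧ y ∈ e

theorem mem_edgesThrough {χ : Finset V → ι} {r : ℕ} {i : ι} {x y : V} {e : Finset V} :
    e ∈ edgesThrough χ r i x y ↔ e.card = r ∧ χ e = i ∧ x ∈ e ∧ y ∈ e := by
  simp [edgesThrough]

theorem edgesThrough_comm (χ : Finset V → ι) (r : ℕ) (i : ι) (x y : V) :
    edgesThrough χ r i x y = edgesThrough χ r i y x := by
  ext e; simp only [mem_edgesThrough]; tauto

/-- The `r`-sets of color `i` contain a Berge-cycle through all vertices. -/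
def HasHamBerge (χ : Finset V → ι) (r : ℕ) (i : ι) : Prop :=
  ∃ (v : Fin (Fintype.card V) → V) (e : Fin (Fintype.card V) → Finset V),
    Function.Injective v ∧ Function.Injective e ∧
      ∀ j, e j ∈ edgesThrough χ r i (v j) (v (cyclicSucc j))

omit [DecidableEq V] in
theorem exists_fin_of_isHamCycle {R : V → V → Prop} {c : Cycle V} (hc : IsHamCycle R c) :
    ∃ v : Fin (Fintype.card V) → V, Function.Injective v ∧ ∀ j, R (v j) (v (cyclicSucc j)) := by
  classical
  induction c using Quotient.inductionOn' with
  | h m =>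
  have hnd : m.Nodup := hc.nodup
  have hmem : ∀ v, v ∈ m := hc.mem
  have hlen : m.length = Fintype.card V := by
    rw [← List.toFinset_card_of_nodup hnd, ← Finset.card_univ]
    congr 1; ext v; simp [hmem v]
  have hch := (cycle_chain_iff_getElem m).1 hc.chain
  refine ⟨fun j => m[j.val]'(by omega), ?_, ?_⟩
  · intro a b hab
    exact Fin.ext (hnd.getElem_inj_iff.1 hab)
  · intro j
    have := hch j.val (by omega)
    simp only [hlen] at this
    exact this

theorem cyclicSucc_injective {n : ℕ} : Function.Injective (cyclicSucc : Fin n → Fin n) := by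
  intro a b h
  simp only [cyclicSucc, Fin.mk.injEq] at h
  apply Fin.ext
  rcases Nat.lt_or_ge (a.val + 1) n with h1 | h1 <;> rcases Nat.lt_or_ge (b.val + 1) n with h2 | h2
  · rw [Nat.mod_eq_of_lt h1, Nat.mod_eq_of_lt h2] at h; omega
  · have h2' : b.val + 1 = n := by omega
    rw [Nat.mod_eq_of_lt h1, h2', Nat.mod_self] at h; omega
  · have h1' : a.val + 1 = n := by omega
    rw [Nat.mod_eq_of_lt h2, h1', Nat.mod_self] at h; omega
  · omega

theorem cyclicSucc_cyclicSucc_ne {n : ℕ} (hn : 3 ≤ n) (j : Fin n) :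
    cyclicSucc (cyclicSucc j) ≠ j := by
  intro h
  have h := congrArg Fin.val h
  simp only [cyclicSucc] at h
  rcases Nat.lt_or_ge (j.val + 1) n with h1 | h1
  · rw [Nat.mod_eq_of_lt h1] at h
    rcases Nat.lt_or_ge (j.val + 1 + 1) n with h2 | h2
    · rw [Nat.mod_eq_of_lt h2] at h; omega
    · have h2' : j.val + 1 + 1 = n := by omega
      rw [h2', Nat.mod_self] at h; omega
  · have h1' : j.val + 1 = n := by omega
    rw [h1', Nat.mod_self, Nat.mod_eq_of_lt (by omega)] at h; omega

omit [Fintype V] [DecidableEq V] in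
theorem consecutive_pair_injective {n : ℕ} (hn : 3 ≤ n) {v : Fin n → V}
    (hv : Function.Injective v) {j k : Fin n}
    (h : s(v j, v (cyclicSucc j)) = s(v k, v (cyclicSucc k))) : j = k := by
  rw [Sym2.eq_iff] at h
  rcases h with h | h
  · exact hv h.1
  · have h1 := hv h.1
    have h2 := hv h.2
    exact absurd (by rw [← h1, h2]) (cyclicSucc_cyclicSucc_ne hn k)

/-- Distinct representatives for the consecutive pairs of a cyclic order of the vertices, some of
which are prescribed. -/
theorem exists_representatives {χ : Finset V → ι} {r n : ℕ} (hr : 0 < r) {i : ι} {v : Fin n → V}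
    (hv : Function.Injective v) (B : Finset (Fin n)) (g : Fin n → Finset V)
    (hg : Set.InjOn g B) (hgB : ∀ j ∈ B, g j ∈ edgesThrough χ r i (v j) (v (cyclicSucc j)))
    (hfree : ∀ j, j ∉ B → r ≤ (edgesThrough χ r i (v j) (v (cyclicSucc j)) \ B.image g).card) :
    ∃ e : Fin n → Finset V, Function.Injective e ∧
      ∀ j, e j ∈ edgesThrough χ r i (v j) (v (cyclicSucc j)) := by
  let t : {j // j ∉ B} → Finset (Finset V) := fun j =>
    edgesThrough χ r i (v j) (v (cyclicSucc j.1)) \ B.image g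
  have hall : ∀ s : Finset {j // j ∉ B}, s.card ≤ (s.biUnion t).card := by
    intro s
    -- Hall's condition by double counting: each index has at least `r` candidates, and an `r`-set
    -- is a candidate for at most `r` indices because it contains the distinct vertices `v j`.
    have h := Finset.card_mul_le_card_mul (fun (j : {j // j ∉ B}) (e : Finset V) => e ∈ t j)
      (s := s) (t := s.biUnion t) (m := r) (n := r) ?_ ?_
    · exact Nat.le_of_mul_le_mul_right h hr
    · intro j hj
      refine (hfree j.1 j.2).trans (Finset.card_le_card ?_)
      intro e he
      rw [Finset.mem_bipartiteAbove]
      exact ⟨Finset.mem_biUnion.2 ⟨j, hj, he⟩, he⟩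
    · intro e he
      obtain ⟨j₀, -, hj₀⟩ := Finset.mem_biUnion.1 he
      have hcard : e.card = r := (mem_edgesThrough.1 (Finset.mem_sdiff.1 hj₀).1).1
      rw [← hcard]
      refine Finset.card_le_card_of_injOn (fun j => v j.1) ?_ ?_
      · intro j hj
        have := (Finset.mem_bipartiteBelow _).1 (Finset.mem_coe.1 hj)
        exact (mem_edgesThrough.1 (Finset.mem_sdiff.1 this.2).1).2.2.1
      · intro a _ b _ hab
        exact Subtype.ext (hv hab)
  obtain ⟨f, hf, hft⟩ := (Finset.all_card_le_biUnion_card_iff_exists_injective t).1 hall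
  refine ⟨fun j => if h : j ∈ B then g j else f ⟨j, h⟩, ?_, ?_⟩
  · intro a b hab
    by_cases ha : a ∈ B <;> by_cases hb : b ∈ B <;> simp only [ha, hb, dite_true, dite_false] at hab
    · exact hg ha hb hab
    · have := (Finset.mem_sdiff.1 (hft ⟨b, hb⟩)).2
      rw [← hab] at this
      exact absurd (Finset.mem_image_of_mem g ha) this
    · have := (Finset.mem_sdiff.1 (hft ⟨a, ha⟩)).2
      rw [hab] at this
      exact absurd (Finset.mem_image_of_mem g hb) this
    · exact congrArg Subtype.val (hf hab)
  · intro j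
    by_cases h : j ∈ B <;> simp only [h, dite_true, dite_false]
    · exact hgB j h
    · exact (Finset.mem_sdiff.1 (hft ⟨j, h⟩)).1

end Lifting

/-! ### The structure of a color without a Hamiltonian Berge-cycle. -/

section Classification

variable {V ι : Type*} [Fintype V] [DecidableEq V] [DecidableEq ι]

/-- The vertices `y` such that few edges of color `i` contain `x` and `y`. -/
def nbr (χ : Finset V → ι) (r : ℕ) (i : ι) (x : V) : Finset V :=
  Finset.univ.filter fun y => x ≠ y ∧ (edgesThrough χ r i x y).card < 2 * r

theorem mem_nbr {χ : Finset V → ι} {r : ℕ} {i : ι} {x y : V} :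
    y ∈ nbr χ r i x ↔ x ≠ y ∧ (edgesThrough χ r i x y).card < 2 * r := by
  simp [nbr]

theorem mem_nbr_comm {χ : Finset V → ι} {r : ℕ} {i : ι} {x y : V} :
    y ∈ nbr χ r i x ↔ x ∈ nbr χ r i y := by
  rw [mem_nbr, mem_nbr, edgesThrough_comm, ne_comm]

/-- No edge of color `i` contains `b` and a vertex outside the small set `Z`. -/
def IsVoid (χ : Finset V → ι) (r : ℕ) (i : ι) (b : V) (Z : Finset V) : Prop :=
  b ∈ Z ∧ Z.card ≤ 60 * r ^ 2 ∧ ∀ x, x ∉ Z → edgesThrough χ r i b x = ∅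

/-- All vertices outside the small set `N` have many neighbours in `nbr χ r i`. -/
def IsSpread (χ : Finset V → ι) (r : ℕ) (i : ι) (N : Finset V) : Prop :=
  N.card ≤ 60 * r ^ 2 ∧ ∀ v, v ∉ N → 11 * r ≤ (nbr χ r i v).card

/-- The degrees in `nbr χ r i` obey the conditions that Chvátal's theorem gives for the complement
of a non-Hamiltonian graph, up to an error in the degrees. -/
structure IsChvatal (χ : Finset V → ι) (r : ℕ) (i : ι) (k : ℕ) (A N : Finset V) : Prop where
  two_mul_lt : 2 * k < Fintype.card V
  le_k : 77 * r ≤ k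
  le_card : k ≤ A.card
  card_le : N.card ≤ k
  le_nbr_of_notMem : ∀ v, v ∉ N → k ≤ (nbr χ r i v).card + 66 * r
  le_nbr_of_mem : ∀ a ∈ A, Fintype.card V ≤ (nbr χ r i a).card + 1 + k + 66 * r

/-- A vertex with fewer than `11 * r` sparse partners has more than `11 * r` non-sparse ones in `E`,
while each member of `E` has at most `143 * r` in all. Double counting leaves at most `286 * r ≤ 60
* r ^ 2` such vertices. -/
theorem isSpread_of_card_eq {χ : Finset V → ι} {r : ℕ} (hr : 5 ≤ r) {i : ι} {E : Finset V}
    (hE : E.card = 22 * r) (h : ∀ a ∈ E, (Finset.univ \ nbr χ r i a).card ≤ 143 * r) :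
    IsSpread χ r i (Finset.univ.filter fun v => (nbr χ r i v).card < 11 * r) := by
  refine ⟨?_, ?_⟩
  · have := Finset.card_mul_le_card_mul (fun (v a : V) => a ∉ nbr χ r i v)
      (s := Finset.univ.filter fun v => (nbr χ r i v).card < 11 * r) (t := E) (m := 11 * r)
      (n := 143 * r) ?_ ?_
    · rw [hE] at this
      have h2 : 22 * r * (143 * r) = (286 * r) * (11 * r) := by ring
      rw [h2] at this
      have := Nat.le_of_mul_le_mul_right this (by omega)
      nlinarith
    · intro v hv
      have hv : (nbr χ r i v).card < 11 * r := by simpa using hv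
      have h1 : (E \ nbr χ r i v) ⊆ Finset.bipartiteAbove (fun (v a : V) => a ∉ nbr χ r i v) E v := by
        intro a ha
        rw [Finset.mem_bipartiteAbove]
        simpa using ha
      have h2 := Finset.card_le_card h1
      have h3 := Finset.le_card_sdiff (nbr χ r i v) E
      omega
    · intro a ha
      refine le_trans (Finset.card_le_card ?_) (h a ha)
      intro v hv
      have := ((Finset.mem_bipartiteBelow _).1 hv).2
      rw [mem_nbr_comm] at this
      simpa using this
  · intro v hv
    simpa using hv

/-- A greedy choice of representatives whose second vertices avoid `E`. -/
theorem exists_private_edges {σ : Type*} [DecidableEq σ] {χ : Finset V → ι} {r : ℕ} (hr : 5 ≤ r)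
    {i : ι} {E : Finset V} (hE : E.card ≤ 22 * r) (a : σ → V)
    (h : ∀ p, 50 * r ^ 2 < (Finset.univ.filter fun y => (edgesThrough χ r i (a p) y).Nonempty).card)
    (I : Finset σ) (hI : I.card ≤ 44 * r) :
    ∃ (y : σ → V) (e : σ → Finset V), Set.InjOn y I ∧ Set.InjOn e I ∧
      ∀ p ∈ I, y p ∉ E ∧ e p ∈ edgesThrough χ r i (a p) (y p) := by
  induction I using Finset.induction_on with
  | empty => exact ⟨a, fun _ => ∅, by simp, by simp, by simp⟩
  | insert p I hp ih =>
    rw [Finset.card_insert_of_notMem hp] at hI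
    obtain ⟨y, e, hy, he, hye⟩ := ih (by omega)
    -- The bound is `22 * r + 44 * r * r`, and `r ≥ 5`. A vertex `z` outside `E` and all earlier
    -- edges makes both the vertex and the edge through it new.
    have hcard : (E ∪ I.biUnion e).card ≤ 50 * r ^ 2 := by
      have h1 : (I.biUnion e).card ≤ I.card * r := by
        apply Finset.card_biUnion_le_card_mul
        intro q hq
        exact (mem_edgesThrough.1 (hye q hq).2).1.le
      have h2 := Finset.card_union_le E (I.biUnion e)
      nlinarith
    obtain ⟨z, hz, hz'⟩ := Finset.exists_mem_notMem_of_card_lt_card (lt_of_le_of_lt hcard (h p))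
    rw [Finset.mem_union, not_or] at hz'
    obtain ⟨f, hf⟩ := (Finset.mem_filter.1 hz).2
    have hzI : ∀ q ∈ I, z ∉ e q := fun q hq hze => hz'.2 (Finset.mem_biUnion.2 ⟨q, hq, hze⟩)
    have hne : ∀ q ∈ I, q ≠ p := fun q hq hqp => hp (hqp ▸ hq)
    refine ⟨Function.update y p z, Function.update e p f, ?_, ?_, ?_⟩
    · rw [Finset.coe_insert, Set.injOn_insert (by simpa using hp)]
      refine ⟨hy.congr fun q hq => by rw [Function.update_of_ne (hne q hq)], ?_⟩
      rintro ⟨q, hq, hqz⟩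
      rw [Function.update_self, Function.update_of_ne (hne q hq)] at hqz
      apply hzI q hq
      rw [← hqz]
      exact (mem_edgesThrough.1 (hye q hq).2).2.2.2
    · rw [Finset.coe_insert, Set.injOn_insert (by simpa using hp)]
      refine ⟨he.congr fun q hq => by rw [Function.update_of_ne (hne q hq)], ?_⟩
      rintro ⟨q, hq, hqz⟩
      rw [Function.update_self, Function.update_of_ne (hne q hq)] at hqz
      apply hzI q hq
      rw [hqz]
      exact (mem_edgesThrough.1 hf).2.2.2
    · intro q hq
      rcases Finset.mem_insert.1 hq with rfl | hq
      · rw [Function.update_self, Function.update_self]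
        exact ⟨hz'.1, hf⟩
      · rw [Function.update_of_ne (hne q hq), Function.update_of_ne (hne q hq)]
        exact hye q hq

omit [DecidableEq V] in
/-- A clique together with disjoint detours through the remaining vertices is Hamiltonian. -/
theorem isHamCycle_of_clique_detours {G : SimpleGraph V} {E : Finset V}
    {Y : V × Bool → V} (hY : Set.InjOn Y {p | p.1 ∈ E}) (hYE : ∀ p, p.1 ∈ E → Y p ∉ E)
    (hcl : ∀ u v, u ∉ E → v ∉ E → u ≠ v → G.Adj u v) (hL : ∀ p, p.1 ∈ E → G.Adj p.1 (Y p))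
    (hcard : 3 * E.card + 2 ≤ Fintype.card V) : ∃ c, IsHamCycle G.Adj c := by
  classical
  set R : Finset V := Finset.univ \ (E ∪ (E ×ˢ (Finset.univ : Finset Bool)).image Y) with hR
  have hRcard : 2 ≤ R.card := by
    have h1 := Finset.le_card_sdiff (E ∪ (E ×ˢ (Finset.univ : Finset Bool)).image Y) Finset.univ
    have h2 := Finset.card_union_le E ((E ×ˢ (Finset.univ : Finset Bool)).image Y)
    have h3 : ((E ×ˢ (Finset.univ : Finset Bool)).image Y).card ≤ E.card * 2 := by
      refine Finset.card_image_le.trans ?_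
      rw [Finset.card_product]; simp
    rw [Finset.card_univ, ← hR] at h1
    omega
  have hRE : ∀ x ∈ R, x ∉ E := by
    intro x hx hxE
    rw [hR] at hx
    simp [hxE] at hx
  have hRY : ∀ p, p.1 ∈ E → Y p ∉ R := by
    intro p hp hpR
    rw [hR, Finset.mem_sdiff, Finset.mem_union, not_or] at hpR
    exact hpR.2.2 (Finset.mem_image_of_mem _ (by simp [hp]))
  -- Start with a path through the clique vertices in `R` that are not used as detour ends, and
  -- prepend `Y (a, false), a, Y (a, true)` for each `a` in `L`. Both ends of the path stay outside
  -- `E`, hence in the clique.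
  have key : ∀ L : List V, L.Nodup → (∀ a ∈ L, a ∈ E) → ∃ l : List V, 2 ≤ l.length ∧ l.Nodup ∧
      l.IsChain G.Adj ∧ (∀ x, x ∈ l ↔ x ∈ R ∨ x ∈ L ∨ ∃ a ∈ L, ∃ β, x = Y (a, β)) ∧
      (∀ h ∈ l.head?, h ∉ E) ∧ (∀ h ∈ l.getLast?, h ∉ E) := by
    intro L
    induction L with
    | nil =>
      intro _ _
      refine ⟨R.toList, by simpa using hRcard, R.nodup_toList, ?_, by simp, ?_, ?_⟩
      · apply List.Pairwise.isChain
        refine (R.nodup_toList.imp_of_mem ?_)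
        intro a b ha hb hab
        exact hcl _ _ (hRE _ (Finset.mem_toList.1 ha)) (hRE _ (Finset.mem_toList.1 hb)) hab
      · intro h hh
        exact hRE _ (Finset.mem_toList.1 (List.mem_of_mem_head? hh))
      · intro h hh
        exact hRE _ (Finset.mem_toList.1 (List.mem_of_mem_getLast? hh))
    | cons a L ih =>
      intro hnd hLE
      rw [List.nodup_cons] at hnd
      have haE : a ∈ E := hLE a (by simp)
      obtain ⟨l, h2, hn, hc, hm, hh, hl⟩ := ih hnd.2 fun b hb => hLE b (by simp [hb])
      have hal : a ∉ l := by
        rw [hm]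
        rintro (h | h | ⟨b, hb, β, h⟩)
        · exact hRE _ h haE
        · exact hnd.1 h
        · exact hYE (b, β) (hLE b (by simp [hb])) (h ▸ haE)
      have hYl : ∀ β, Y (a, β) ∉ l := by
        intro β
        rw [hm]
        rintro (h | h | ⟨b, hb, γ, h⟩)
        · exact hRY _ haE h
        · exact hYE (a, β) haE (hLE _ (by simp [h]))
        · have := hY (show (a, β).1 ∈ E from haE) (show (b, γ).1 ∈ E from hLE b (by simp [hb])) h
          simp only [Prod.mk.injEq] at this
          exact hnd.1 (this.1 ▸ hb)
      have hYa : ∀ β, Y (a, β) ≠ a := fun β h => hYE (a, β) haE (by rw [h]; exact haE)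
      have hYY : Y (a, false) ≠ Y (a, true) := by
        intro h
        have := hY (show (a, false).1 ∈ E from haE) (show (a, true).1 ∈ E from haE) h
        simp at this
      refine ⟨Y (a, false) :: a :: Y (a, true) :: l, by simp, ?_, ?_, ?_, ?_, ?_⟩
      · simp only [List.nodup_cons, List.mem_cons, not_or]
        exact ⟨⟨hYa _, hYY, hYl _⟩, ⟨(hYa _).symm, hal⟩, hYl _, hn⟩
      · rw [List.isChain_cons, List.isChain_cons, List.isChain_cons]
        refine ⟨?_, ?_, ?_, hc⟩
        · intro y hy
          simp at hy; subst hy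
          exact (hL (a, false) haE).symm
        · intro y hy
          simp at hy; subst hy
          exact hL (a, true) haE
        · intro y hy
          refine hcl _ _ (hYE _ haE) (hh y hy) ?_
          intro h
          exact hYl true (h ▸ List.mem_of_mem_head? hy)
      · intro x
        simp only [List.mem_cons, hm, exists_eq_or_imp, Bool.exists_bool]
        generalize (∃ b ∈ L, x = Y (b, false) ∨ x = Y (b, true)) = p
        tauto
      · intro h hh
        simp at hh; subst hh
        exact hYE _ haE
      · intro h hh
        apply hl
        cases l with
        | nil => simp at h2
        | cons b l => simpa using hh
  obtain ⟨l, h2, hn, hc, hm, hh, hl⟩ := key E.toList E.nodup_toList (by simp)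
  have hne : l ≠ [] := by rintro rfl; simp at h2
  refine ⟨l, isHamCycle_of_path hne hn ?_ hc ?_⟩
  · intro x
    rw [hm]
    by_cases hx : x ∈ R
    · exact Or.inl hx
    · right
      rw [hR] at hx
      simp only [Finset.mem_sdiff, Finset.mem_univ, true_and, not_not, Finset.mem_union,
        Finset.mem_image, Finset.mem_product, and_true] at hx
      rcases hx with hx | ⟨⟨b, β⟩, hb, rfl⟩
      · exact Or.inl (by simpa using hx)
      · exact Or.inr ⟨b, by simpa using hb, β, rfl⟩
  · refine hcl _ _ (hl _ (List.getLast?_eq_some_getLast hne)) (hh _ (List.head?_eq_some_head hne)) ?_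
    rw [List.getLast_eq_getElem, List.head_eq_getElem]
    intro h
    have := hn.getElem_inj_iff.1 h
    omega

-- The set `E` collects the vertices of too small degree for the closure argument. Outside `E`,
-- passing from non-sparse pairs to the graph `G` costs at most `3 * E.card ≤ 66 * r` in the degree.
-- As `143 = 77 + 66`, a vertex outside `E` has degree at least `77 * r`, and `77 - 66 = 11` gives
-- the sparse degree required of ordinary vertices.
open Classical in
theorem exists_isChvatal {χ : Finset V → ι} {r : ℕ} (hr : 5 ≤ r) {i : ι}
    (hV : 200 * r ^ 4 < Fintype.card V) (hham : ¬ HasHamBerge χ r i) {E : Finset V}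
    (hmemE : ∀ v, v ∈ E ↔ (Finset.univ \ nbr χ r i v).card ≤ 143 * r) (hE : E.card ≤ 22 * r)
    (hshadow : ∀ b, 50 * r ^ 2 <
      (Finset.univ.filter fun y => (edgesThrough χ r i b y).Nonempty).card) :
    ∃ k A N, IsChvatal χ r i k A N := by
  have hrV : 1000 * r < Fintype.card V := by
    have h1 : 5 ^ 3 ≤ r ^ 3 := Nat.pow_le_pow_left hr 3
    have h2 := Nat.mul_le_mul_right r h1
    rw [← pow_succ, show 3 + 1 = 4 from rfl] at h2
    omega
  have : Nonempty V := Fintype.card_pos_iff.1 (by omega)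
  set n := Fintype.card V with hn
  -- Each `a` in `E` receives two private edges, one for each of its neighbors on the cycle.
  obtain ⟨Y, e, hY, he, hYe⟩ := exists_private_edges hr (χ := χ) (i := i) (E := E) hE
    (fun p : V × Bool => p.1) (fun p => hshadow p.1) (E ×ˢ Finset.univ)
    (by rw [Finset.card_product]; simp; omega)
  have hslot : ∀ p : V × Bool, p ∈ E ×ˢ (Finset.univ : Finset Bool) ↔ p.1 ∈ E := by simp
  simp only [hslot] at hYe
  have hY' : Set.InjOn Y {p | p.1 ∈ E} := by
    convert hY using 1; ext p; simp
  have he' : Set.InjOn e {p | p.1 ∈ E} := by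
    convert he using 1; ext p; simp
  set F : Finset (Finset V) := (E ×ˢ (Finset.univ : Finset Bool)).image e with hF
  have hFcard : F.card ≤ 2 * E.card := by
    refine Finset.card_image_le.trans ?_
    rw [Finset.card_product]; simp; omega
  -- `Γ` consists of the pairs with many unreserved edges and of the reserved pairs
  let Γ : SimpleGraph V :=
    { Adj := fun x y => x ≠ y ∧ ((x ∉ E ∧ y ∉ E ∧ r ≤ (edgesThrough χ r i x y \ F).card) ∨
        ∃ p : V × Bool, p.1 ∈ E ∧ s(x, y) = s(p.1, Y p))
      symm := ⟨by
        rintro x y ⟨h, h'⟩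
        refine ⟨h.symm, ?_⟩
        rcases h' with ⟨h1, h2, h3⟩ | ⟨p, hp, h3⟩
        · exact Or.inl ⟨h2, h1, by rwa [edgesThrough_comm]⟩
        · exact Or.inr ⟨p, hp, by rw [Sym2.eq_swap, h3]⟩⟩
      loopless := ⟨fun x h => h.1 rfl⟩ }
  have hΓham : ¬ ∃ c, IsHamCycle Γ.Adj c := by
    rintro ⟨c, hc⟩
    apply hham
    obtain ⟨v, hv, hadj⟩ := exists_fin_of_isHamCycle hc
    let B : Finset (Fin (Fintype.card V)) := Finset.univ.filter fun j =>
      ∃ p : V × Bool, p.1 ∈ E ∧ s(v j, v (cyclicSucc j)) = s(p.1, Y p)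
    have hB : ∀ j, j ∈ B → ∃ p : V × Bool, p.1 ∈ E ∧ s(v j, v (cyclicSucc j)) = s(p.1, Y p) := by
      intro j hj
      simpa [B] using hj
    choose! p hp hps using hB
    -- Reserved pairs on the cycle take their reserved edges; the other pairs keep at least `r`
    -- unreserved edges, so representatives exist.
    have hinj : Set.InjOn (fun j => e (p j)) B := by
      intro j hj k hk hjk
      have := he' (hp j hj) (hp k hk) hjk
      apply consecutive_pair_injective (by omega) hv
      rw [hps j hj, hps k hk, this]
    have H := exists_representatives (χ := χ) (r := r) (i := i) (by omega) hv B
      (fun j => e (p j)) hinj ?_ ?_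
    · obtain ⟨f, hf, hft⟩ := H
      exact ⟨v, f, hv, hf, hft⟩
    · intro j hj
      have h1 := (hYe (p j) (hp j hj)).2
      have h2 := hps j hj
      rw [Sym2.eq_iff] at h2
      rcases h2 with ⟨a, b⟩ | ⟨a, b⟩
      · rw [a, b]; exact h1
      · rw [a, b, edgesThrough_comm]; exact h1
    · intro j hj
      rcases (hadj j).2 with ⟨-, -, h⟩ | h
      · refine h.trans (Finset.card_le_card (Finset.sdiff_subset_sdiff le_rfl ?_))
        intro f hf
        obtain ⟨k, hk, rfl⟩ := Finset.mem_image.1 hf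
        exact Finset.mem_image_of_mem _ ((hslot _).2 (hp k hk))
      · exact absurd (by simpa [B] using h) hj
  -- Were the complement of `E` a clique, the detours would close up to a Hamiltonian cycle. The
  -- saturated graph thus misses a pair outside `E`.
  obtain ⟨G, hΓG, hGΓ, ⟨u₀, v₀, huv₀⟩, hsat⟩ := exists_saturated Γ (E : Set V) (by omega) hΓham (by
    intro G hG hcl
    refine isHamCycle_of_clique_detours hY' (fun p hp => (hYe p hp).1) (by simpa using hcl) ?_
      (by omega)
    intro p hp
    apply hG
    refine ⟨?_, Or.inr ⟨p, hp, rfl⟩⟩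
    intro h
    exact (hYe p hp).1 (h ▸ hp))
  simp only [Finset.mem_coe] at hGΓ huv₀ hsat
  -- the pairs that are in `nbr` only after reservation are few
  have hspoil : ∀ w, (Finset.univ.filter fun x => r < (F ∩ edgesThrough χ r i w x).card).card
      ≤ F.card := by
    intro w
    have := Finset.card_mul_le_card_mul (fun (x : V) (f : Finset V) => f ∈ edgesThrough χ r i w x)
      (s := Finset.univ.filter fun x => r < (F ∩ edgesThrough χ r i w x).card) (t := F) (m := r)
      (n := r) ?_ ?_
    · exact Nat.le_of_mul_le_mul_right this (by omega)
    · intro x hx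
      have hx : r < (F ∩ edgesThrough χ r i w x).card := by simpa using hx
      refine hx.le.trans (Finset.card_le_card ?_)
      intro f hf
      rw [Finset.mem_bipartiteAbove]
      exact Finset.mem_inter.1 hf
    · intro f hf
      obtain ⟨p, hp, rfl⟩ := Finset.mem_image.1 hf
      have h1 := (mem_edgesThrough.1 (hYe p ((hslot p).1 hp)).2).1
      refine le_trans (Finset.card_le_card ?_) h1.le
      intro x hx
      exact (mem_edgesThrough.1 ((Finset.mem_bipartiteBelow _).1 hx).2).2.2.2
  -- A non-sparse partner of `w` that is not adjacent to it in `G` is `w` itself, lies in `E`, or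
  -- has more than `r` reserved edges in common with `w`. The last kind numbers at most `F.card ≤ 2
  -- * E.card`.
  have hdeg : ∀ w, w ∉ E → (Finset.univ \ nbr χ r i w).card ≤ G.degree w + 1 + 3 * E.card := by
    intro w hw
    have hsub : Finset.univ \ nbr χ r i w ⊆ ((G.neighborFinset w ∪ {w}) ∪ E) ∪
        Finset.univ.filter fun x => r < (F ∩ edgesThrough χ r i w x).card := by
      intro x hx
      have hx : x ∉ nbr χ r i w := by simpa using hx
      by_contra hcon
      simp only [Finset.mem_union, not_or, SimpleGraph.mem_neighborFinset, Finset.mem_singleton,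
        Finset.mem_filter, Finset.mem_univ, true_and, not_lt] at hcon
      obtain ⟨⟨⟨h1, h2⟩, h3⟩, h4⟩ := hcon
      apply h1
      apply hΓG
      refine ⟨fun h => h2 h.symm, Or.inl ⟨hw, h3, ?_⟩⟩
      rw [mem_nbr] at hx
      have h5 : 2 * r ≤ (edgesThrough χ r i w x).card := by
        by_contra h
        exact hx ⟨fun h => h2 h.symm, by omega⟩
      have h6 := Finset.card_sdiff_add_card_inter (edgesThrough χ r i w x) F
      rw [Finset.inter_comm] at h4
      omega
    have h1 := Finset.card_le_card hsub
    have h2 := Finset.card_union_le ((G.neighborFinset w ∪ {w}) ∪ E)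
      (Finset.univ.filter fun x => r < (F ∩ edgesThrough χ r i w x).card)
    have h3 := Finset.card_union_le (G.neighborFinset w ∪ {w}) E
    have h4 := Finset.card_union_le (G.neighborFinset w) {w}
    have h5 := hspoil w
    rw [SimpleGraph.card_neighborFinset_eq_degree, Finset.card_singleton] at h4
    omega
  have hcompl : ∀ w, (Finset.univ \ nbr χ r i w).card + (nbr χ r i w).card = n := by
    intro w
    rw [Finset.card_sdiff_add_card_eq_card (Finset.subset_univ _), Finset.card_univ]
  -- a nonadjacent pair of maximal degree sum
  obtain ⟨⟨u, v⟩, huv, hmax⟩ := Finset.exists_max_image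
    (Finset.univ.filter fun q : V × V => q.1 ∉ E ∧ q.2 ∉ E ∧ q.1 ≠ q.2 ∧ ¬ G.Adj q.1 q.2)
    (fun q => G.degree q.1 + G.degree q.2) ⟨(u₀, v₀), by simpa using huv₀⟩
  simp only [Finset.mem_filter, Finset.mem_univ, true_and, Prod.forall] at huv hmax
  wlog huvd : G.degree u ≤ G.degree v generalizing u v
  · refine this v u ⟨huv.2.1, huv.1, huv.2.2.1.symm, fun h => huv.2.2.2 h.symm⟩ ?_ (by omega)
    intro a b hab
    have := hmax a b hab
    omega
  obtain ⟨hu, hv, hne, hnadj⟩ := huv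
  have hsum := hsat u v hu hv hne hnadj
  have hdu := hdeg u hu
  have hu' : ¬ (Finset.univ \ nbr χ r i u).card ≤ 143 * r := fun h => hu ((hmemE u).2 h)
  -- The set `A` consists of `E` and the non-neighbors of `v`, and `N` of the neighbors of `u`
  -- outside `E`. By maximality of the degree sum, a non-neighbor of `v` has degree at most that of
  -- `u`, and a non-neighbor of `u` at most that of `v`, which is below `n - k`.
  refine ⟨G.degree u, E ∪ Finset.univ.filter fun w => w ∉ E ∧ w ≠ v ∧ ¬ G.Adj v w,
    G.neighborFinset u \ E, ⟨by omega, by omega, ?_, ?_, ?_, ?_⟩⟩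
  · have hsub : (Finset.univ : Finset V) ⊆ (G.neighborFinset v ∪ {v}) ∪
        (E ∪ Finset.univ.filter fun w => w ∉ E ∧ w ≠ v ∧ ¬ G.Adj v w) := by
      intro x _
      simp only [Finset.mem_union, SimpleGraph.mem_neighborFinset, Finset.mem_singleton,
        Finset.mem_filter, Finset.mem_univ, true_and]
      tauto
    have h1 := Finset.card_le_card hsub
    have h2 := Finset.card_union_le (G.neighborFinset v ∪ {v})
      (E ∪ Finset.univ.filter fun w => w ∉ E ∧ w ≠ v ∧ ¬ G.Adj v w)
    have h3 := Finset.card_union_le (G.neighborFinset v) {v}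
    rw [SimpleGraph.card_neighborFinset_eq_degree, Finset.card_singleton] at h3
    rw [Finset.card_univ] at h1
    omega
  · refine (Finset.card_le_card Finset.sdiff_subset).trans ?_
    rw [SimpleGraph.card_neighborFinset_eq_degree]
  · intro w hw
    have h3 := hcompl w
    by_cases hwE : w ∈ E
    · have := (hmemE w).1 hwE
      omega
    · have h1 := hdeg w hwE
      have h2 : G.degree w ≤ G.degree v := by
        by_cases hwu : w = u
        · rw [hwu]; exact huvd
        · have hna : ¬ G.Adj u w := by
            intro h
            apply hw
            simp [h, hwE]
          have := hmax u w ⟨hu, hwE, fun h => hwu h.symm, hna⟩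
          omega
      omega
  · intro w hw
    have h3 := hcompl w
    by_cases hwE : w ∈ E
    · have := (hmemE w).1 hwE
      omega
    · have h1 := hdeg w hwE
      have hw' : w ≠ v ∧ ¬ G.Adj v w := by
        simp [hwE] at hw
        exact hw
      have := hmax w v ⟨hwE, hv, hw'.1, fun h => hw'.2 h.symm⟩
      omega

/-- The three possibilities for a color without a Hamiltonian Berge-cycle. -/
theorem color_trichotomy {χ : Finset V → ι} {r : ℕ} (hr : 5 ≤ r) {i : ι}
    (hV : 200 * r ^ 4 < Fintype.card V) (hham : ¬ HasHamBerge χ r i) :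
    (∃ b Z, IsVoid χ r i b Z) ∨ (∃ N, IsSpread χ r i N) ∨ ∃ k A N, IsChvatal χ r i k A N := by
  by_cases hvoid : ∃ b Z, IsVoid χ r i b Z
  · exact Or.inl hvoid
  right
  have hshadow : ∀ b, 50 * r ^ 2 <
      (Finset.univ.filter fun y => (edgesThrough χ r i b y).Nonempty).card := by
    intro b
    by_contra hcon
    apply hvoid
    refine ⟨b, insert b (Finset.univ.filter fun y => (edgesThrough χ r i b y).Nonempty),
      Finset.mem_insert_self _ _, ?_, ?_⟩
    · refine (Finset.card_insert_le _ _).trans ?_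
      nlinarith
    · intro x hx
      simp only [Finset.mem_insert, Finset.mem_filter, Finset.mem_univ, true_and, not_or] at hx
      exact Finset.not_nonempty_iff_eq_empty.1 hx.2
  set E : Finset V := Finset.univ.filter fun v => (Finset.univ \ nbr χ r i v).card ≤ 143 * r with hE
  have hmemE : ∀ v, v ∈ E ↔ (Finset.univ \ nbr χ r i v).card ≤ 143 * r := by simp [hE]
  rcases Nat.lt_or_ge (22 * r) E.card with h | h
  · obtain ⟨E', hE', hcard⟩ := Finset.exists_subset_card_eq h.le
    exact Or.inl ⟨_, isSpread_of_card_eq hr hcard fun a ha => (hmemE a).1 (hE' ha)⟩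
  · exact Or.inr (exists_isChvatal hr hV hham hmemE h hshadow)

end Classification

/-! ### Counting the extensions of small sets; matching of colors. -/

section Counting

variable {V ι : Type*} [Fintype V] [DecidableEq V] [DecidableEq ι]

theorem card_image_insert_le {χ : Finset V → ι} {r : ℕ} {i : ι} {u v : V} {β : Type*}
    (h : v ∈ nbr χ r i u) (s : Finset β) (f : β → Finset V) (hf : Set.InjOn f s)
    (hs : ∀ p ∈ s, (f p).card = r ∧ χ (f p) = i ∧ u ∈ f p ∧ v ∈ f p) : s.card ≤ 2 * r := by
  refine le_trans ?_ (mem_nbr.1 h).2.le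
  exact Finset.card_le_card_of_injOn f (fun p hp => mem_edgesThrough.2 (hs p hp)) hf

variable [Fintype ι]

/-- There is no family of sets `W ∪ {x, y}` in which the color can neither be a function of `W`
nor be determined by both `x` and `y`. -/
theorem false_of_two_free {χ : Finset V → ι} {r : ℕ} (hr : 5 ≤ r)
    (hι : Fintype.card ι = r - 1) {W X Y : Finset V} (hW : W.card + 2 = r)
    (hXW : Disjoint X W) (hYW : Disjoint Y W) (hX : 5 * r ≤ X.card) (hY : 10 * r ≤ Y.card)
    (i₁ i₂ : ι)
    (h₁ : ∀ x ∈ X, ∃ u ∈ insert x W, ∃ v ∈ insert x W, v ∈ nbr χ r i₁ u)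
    (h₂ : ∀ y ∈ Y, ∃ u ∈ insert y W, ∃ v ∈ insert y W, v ∈ nbr χ r i₂ u)
    (h : ∀ i, i ≠ i₁ → i ≠ i₂ → (∃ u ∈ W, ∃ v ∈ W, v ∈ nbr χ r i u) ∨
      ∀ x ∈ X, ∃ u ∈ insert x W, ∃ v ∈ insert x W, edgesThrough χ r i u v = ∅) : False := by
  obtain ⟨X', hX'X, hX'⟩ := Finset.exists_subset_card_eq hX
  have hY2 : 5 * r ≤ (Y \ X').card := by
    have := Finset.le_card_sdiff X' Y
    omega
  obtain ⟨Y', hY'Y, hY'⟩ := Finset.exists_subset_card_eq hY2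
  have hxW : ∀ x ∈ X', x ∉ W := fun x hx => Finset.disjoint_left.1 hXW (hX'X hx)
  have hyW : ∀ y ∈ Y', y ∉ W := fun y hy =>
    Finset.disjoint_left.1 hYW (Finset.mem_sdiff.1 (hY'Y hy)).1
  have hyX : ∀ y ∈ Y', y ∉ X' := fun y hy => (Finset.mem_sdiff.1 (hY'Y hy)).2
  let f : V × V → Finset V := fun p => insert p.1 (insert p.2 W)
  have hfc : ∀ p ∈ X' ×ˢ Y', (f p).card = r := by
    rintro ⟨x, y⟩ hp
    rw [Finset.mem_product] at hp
    have hxy : x ≠ y := fun h => hyX y hp.2 (h ▸ hp.1)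
    simp only [f]
    rw [Finset.card_insert_of_notMem, Finset.card_insert_of_notMem (hyW y hp.2), hW]
    simp [hxy, hxW x hp.1]
  have hinj : Set.InjOn f (X' ×ˢ Y' : Finset (V × V)) := by
    rintro ⟨x, y⟩ hp ⟨x', y'⟩ hp' heq
    rw [Finset.mem_coe, Finset.mem_product] at hp hp'
    simp only [f] at heq
    have a : x ∈ insert x' (insert y' W) := heq ▸ Finset.mem_insert_self _ _
    have b : y ∈ insert x' (insert y' W) :=
      heq ▸ Finset.mem_insert_of_mem (Finset.mem_insert_self _ _)
    simp only [Finset.mem_insert] at a b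
    have a' : x = x' := by
      rcases a with a | a | a
      · exact a
      · exact absurd hp.1 (a ▸ hyX y' hp'.2)
      · exact absurd a (hxW x hp.1)
    have b' : y = y' := by
      rcases b with b | b | b
      · exact absurd hp'.1 (b ▸ hyX y hp.2)
      · exact b
      · exact absurd b (hyW y hp.2)
    rw [a', b']
  have hsubX : ∀ p : V × V, insert p.1 W ⊆ f p := fun p =>
    Finset.insert_subset_insert _ (Finset.subset_insert _ _)
  have hsubY : ∀ p : V × V, insert p.2 W ⊆ f p := fun p => Finset.subset_insert _ _
  have hsubW : ∀ p : V × V, W ⊆ f p := fun p => (Finset.subset_insert _ _).trans (hsubY p)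
  -- There are `25 * r ^ 2` sets `f p`. For `i₁` each `x` allows at most `2 * r` of them, for `i₂`
  -- each `y` does, and any other color has at most `2 * r` in total: at most `20 * r ^ 2 + 2 * r *
  -- (r - 1)`, which is too few.
  have hfib : ∀ i : ι, ((X' ×ˢ Y').filter fun p => χ (f p) = i).card ≤
      2 * r + (if i = i₁ then 10 * r ^ 2 else 0) + (if i = i₂ then 10 * r ^ 2 else 0) := by
    intro i
    by_cases hi₁ : i = i₁
    · have hle : ((X' ×ˢ Y').filter fun p => χ (f p) = i).card ≤ 2 * r * X'.card := by
        apply Finset.card_le_mul_card_image_of_maps_to (f := Prod.fst)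
        · intro p hp
          exact (Finset.mem_product.1 (Finset.mem_filter.1 hp).1).1
        · intro x hx
          obtain ⟨u, hu, v, hv, huv⟩ := h₁ x (hX'X hx)
          apply card_image_insert_le huv _ f
          · exact hinj.mono fun p hp => (Finset.mem_filter.1 (Finset.mem_filter.1 hp).1).1
          · intro p hp
            simp only [Finset.mem_filter] at hp
            obtain ⟨⟨hp, hc⟩, rfl⟩ := hp
            exact ⟨hfc p hp, hc.trans hi₁, hsubX p hu, hsubX p hv⟩
      rw [hX'] at hle
      have h10 : 2 * r * (5 * r) = 10 * r ^ 2 := by ring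
      rw [if_pos hi₁]
      omega
    by_cases hi₂ : i = i₂
    · have hle : ((X' ×ˢ Y').filter fun p => χ (f p) = i).card ≤ 2 * r * Y'.card := by
        apply Finset.card_le_mul_card_image_of_maps_to (f := Prod.snd)
        · intro p hp
          exact (Finset.mem_product.1 (Finset.mem_filter.1 hp).1).2
        · intro y hy
          obtain ⟨u, hu, v, hv, huv⟩ := h₂ y (Finset.mem_sdiff.1 (hY'Y hy)).1
          apply card_image_insert_le huv _ f
          · exact hinj.mono fun p hp => (Finset.mem_filter.1 (Finset.mem_filter.1 hp).1).1
          · intro p hp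
            simp only [Finset.mem_filter] at hp
            obtain ⟨⟨hp, hc⟩, rfl⟩ := hp
            exact ⟨hfc p hp, hc.trans hi₂, hsubY p hu, hsubY p hv⟩
      rw [hY'] at hle
      have h10 : 2 * r * (5 * r) = 10 * r ^ 2 := by ring
      rw [if_neg hi₁, if_pos hi₂]
      omega
    rw [if_neg hi₁, if_neg hi₂, add_zero, add_zero]
    rcases h i hi₁ hi₂ with ⟨u, hu, v, hv, huv⟩ | h
    · apply card_image_insert_le huv _ f
      · exact hinj.mono fun p hp => (Finset.mem_filter.1 hp).1
      · intro p hp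
        rw [Finset.mem_filter] at hp
        exact ⟨hfc p hp.1, hp.2, hsubW p hu, hsubW p hv⟩
    · rw [Finset.card_eq_zero.2]
      · omega
      rw [Finset.filter_eq_empty_iff]
      intro p hp hc
      obtain ⟨u, hu, v, hv, huv⟩ := h p.1 (hX'X (Finset.mem_product.1 hp).1)
      have : f p ∈ edgesThrough χ r i u v :=
        mem_edgesThrough.2 ⟨hfc p hp, hc, hsubX p hu, hsubX p hv⟩
      simp [huv] at this
  have htot := Finset.card_eq_sum_card_fiberwise (f := fun p => χ (f p)) (s := X' ×ˢ Y')
    (t := Finset.univ) (fun p _ => Finset.mem_coe.2 (Finset.mem_univ _))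
  have hle := Finset.sum_le_sum fun i (_ : i ∈ Finset.univ) => hfib i
  rw [← htot, Finset.card_product, hX', hY', Finset.sum_add_distrib, Finset.sum_add_distrib,
    Finset.sum_const, Finset.card_univ, hι, Finset.sum_ite_eq' , Finset.sum_ite_eq'] at hle
  simp only [Finset.mem_univ, if_true, smul_eq_mul] at hle
  obtain ⟨m, rfl⟩ : ∃ m, r = m + 1 := ⟨r - 1, by omega⟩
  simp only [Nat.add_sub_cancel] at hle
  nlinarith

/-- Padding `W` to `r - 2` vertices removes at most `r` elements from `X` and `Y`; this is why `11 *
r` is the threshold for sparse degrees throughout. -/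
theorem false_of_two_free_of_le {χ : Finset V → ι} {r : ℕ} (hr : 5 ≤ r)
    (hι : Fintype.card ι = r - 1) {W X Y : Finset V} (hW : W.card + 2 ≤ r)
    (hX : 11 * r ≤ X.card) (hY : 11 * r ≤ Y.card) (i₁ i₂ : ι)
    (h₁ : ∀ x ∈ X, ∃ u ∈ insert x W, ∃ v ∈ insert x W, v ∈ nbr χ r i₁ u)
    (h₂ : ∀ y ∈ Y, ∃ u ∈ insert y W, ∃ v ∈ insert y W, v ∈ nbr χ r i₂ u)
    (h : ∀ i, i ≠ i₁ → i ≠ i₂ → (∃ u ∈ W, ∃ v ∈ W, v ∈ nbr χ r i u) ∨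
      ∀ x ∈ X, ∃ u ∈ insert x W, ∃ v ∈ insert x W, edgesThrough χ r i u v = ∅) : False := by
  have hcard : r - 2 ≤ Fintype.card V := by
    have := Finset.card_le_univ X
    omega
  obtain ⟨W', hWW', hW'⟩ := Finset.exists_superset_card_eq (s := W) (n := r - 2) (by omega) hcard
  have hs : ∀ x, insert x W ⊆ insert x W' := fun x => Finset.insert_subset_insert _ hWW'
  refine false_of_two_free (χ := χ) hr hι (W := W') (X := X \ W') (Y := Y \ W') (by omega)
    Finset.sdiff_disjoint Finset.sdiff_disjoint ?_ ?_ i₁ i₂ ?_ ?_ ?_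
  · have := Finset.le_card_sdiff W' X
    omega
  · have := Finset.le_card_sdiff W' Y
    omega
  · intro x hx
    obtain ⟨u, hu, v, hv, huv⟩ := h₁ x (Finset.mem_sdiff.1 hx).1
    exact ⟨u, hs x hu, v, hs x hv, huv⟩
  · intro x hx
    obtain ⟨u, hu, v, hv, huv⟩ := h₂ x (Finset.mem_sdiff.1 hx).1
    exact ⟨u, hs x hu, v, hs x hv, huv⟩
  · intro i hi₁ hi₂
    rcases h i hi₁ hi₂ with ⟨u, hu, v, hv, huv⟩ | h
    · exact Or.inl ⟨u, hWW' hu, v, hWW' hv, huv⟩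
    · refine Or.inr fun x hx => ?_
      obtain ⟨u, hu, v, hv, huv⟩ := h x (Finset.mem_sdiff.1 hx).1
      exact ⟨u, hs x hu, v, hs x hv, huv⟩

/-- If every color is void at a vertex of `W` or has a pair in `W`, then `W` has `r` vertices. -/
theorem false_of_one_free {χ : Finset V → ι} {r : ℕ} (hr : 5 ≤ r)
    (hι : Fintype.card ι = r - 1) {W Z : Finset V} (hW : W.card + 1 ≤ r)
    (hZ : r + 2 * r ^ 2 + Z.card < Fintype.card V)
    (h : ∀ i, (∃ u ∈ W, ∃ v ∈ W, v ∈ nbr χ r i u) ∨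
      ∀ x, x ∉ Z → ∃ u ∈ W, edgesThrough χ r i u x = ∅) : False := by
  obtain ⟨W', hWW', hW'⟩ := Finset.exists_superset_card_eq (s := W) (n := r - 1) (by omega)
    (by omega)
  set X := Finset.univ \ (W' ∪ Z) with hX
  have hXW : ∀ x ∈ X, x ∉ W' ∧ x ∉ Z := by
    intro x hx
    simpa [hX] using hx
  have hcard : ∀ x ∈ X, (insert x W').card = r := by
    intro x hx
    rw [Finset.card_insert_of_notMem (hXW x hx).1]
    omega
  -- At most `2 * r` extensions per color cover fewer than `2 * r ^ 2` vertices `x`, but `X` is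
  -- larger.
  have hfib : ∀ i : ι, (X.filter fun x => χ (insert x W') = i).card ≤ 2 * r := by
    intro i
    rcases h i with ⟨u, hu, v, hv, huv⟩ | h
    · apply card_image_insert_le huv _ (fun x => insert x W')
      · intro x hx y hy hxy
        have hx : x ∈ X := (Finset.mem_filter.1 hx).1
        have : x ∈ insert y W' := by
          simp only at hxy
          rw [← hxy]; exact Finset.mem_insert_self _ _
        rcases Finset.mem_insert.1 this with h | h
        · exact h
        · exact absurd h (hXW x hx).1
      · intro x hx
        rw [Finset.mem_filter] at hx
        exact ⟨hcard x hx.1, hx.2, Finset.mem_insert_of_mem (hWW' hu),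
          Finset.mem_insert_of_mem (hWW' hv)⟩
    · rw [Finset.card_eq_zero.2]
      · omega
      rw [Finset.filter_eq_empty_iff]
      intro x hx hc
      obtain ⟨u, hu, hux⟩ := h x (hXW x hx).2
      have : insert x W' ∈ edgesThrough χ r i u x :=
        mem_edgesThrough.2 ⟨hcard x hx, hc, Finset.mem_insert_of_mem (hWW' hu),
          Finset.mem_insert_self _ _⟩
      simp [hux] at this
  have htot := Finset.card_eq_sum_card_fiberwise (f := fun x => χ (insert x W')) (s := X)
    (t := Finset.univ) (fun p _ => Finset.mem_coe.2 (Finset.mem_univ _))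
  have hle := Finset.sum_le_sum fun i (_ : i ∈ Finset.univ) => hfib i
  rw [← htot, Finset.sum_const, Finset.card_univ, hι, smul_eq_mul] at hle
  have h1 := Finset.le_card_sdiff (W' ∪ Z) Finset.univ
  have h2 := Finset.card_union_le W' Z
  rw [← hX, Finset.card_univ] at h1
  have h3 : (r - 1) * (2 * r) ≤ r * (2 * r) := Nat.mul_le_mul_right _ (by omega)
  have h4 : r * (2 * r) = 2 * r ^ 2 := by ring
  omega

/-- The pairs that lie in `nbr` for both colors. -/
def sharedPairs (χ : Finset V → ι) (r : ℕ) (i j : ι) : Finset (Finset V) :=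
  Finset.univ.filter fun g => ∃ u v, g = {u, v} ∧ v ∈ nbr χ r i u ∧ v ∈ nbr χ r j u

-- This turns a bound on common sparse pairs into near-disjointness of the sparse neighborhoods at
-- every vertex.
omit [Fintype ι] in
theorem card_nbr_inter_nbr_le {χ : Finset V → ι} {r : ℕ} {i j : ι} (s : V) :
    (nbr χ r i s ∩ nbr χ r j s).card ≤ (sharedPairs χ r i j).card := by
  refine Finset.card_le_card_of_injOn (fun v => {s, v}) ?_ ?_
  · intro v hv
    rw [Finset.mem_coe, Finset.mem_inter] at hv
    simp only [sharedPairs, Finset.coe_filter, Finset.mem_univ, true_and, Set.mem_ofPred_eq]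
    exact ⟨s, v, rfl, hv.1, hv.2⟩
  · intro v hv w hw hvw
    rw [Finset.mem_coe, Finset.mem_inter, mem_nbr] at hv
    have : v ∈ ({s, w} : Finset V) := by
      simp only at hvw
      rw [← hvw]; simp
    simp only [Finset.mem_insert, Finset.mem_singleton] at this
    rcases this with h | h
    · exact absurd h.symm hv.1.1
    · exact h

omit [Fintype ι] in
/-- Pairs of colors with common pairs are removed as long as there are any. -/
theorem exists_matching {χ : Finset V → ι} {r : ℕ} (hr : 0 < r) (J : Finset ι) :
    ∃ (Q : Finset ι) (U : Finset V), Q ⊆ J ∧ U.card + Q.card ≤ J.card ∧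
      (∀ i ∈ J, i ∉ Q → ∃ u ∈ U, ∃ v ∈ U, v ∈ nbr χ r i u) ∧
      ∀ i ∈ Q, ∀ j ∈ Q, i ≠ j → (sharedPairs χ r i j).card < 2 * r := by
  induction J using Finset.strongInduction with
  | H J ih =>
    by_cases hJ : ∃ i ∈ J, ∃ j ∈ J, i ≠ j ∧ 2 * r ≤ (sharedPairs χ r i j).card
    · obtain ⟨i, hi, j, hj, hij, hs⟩ := hJ
      have hjJ : j ∈ J.erase i := Finset.mem_erase.2 ⟨hij.symm, hj⟩
      have hc1 := Finset.card_erase_of_mem hi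
      have hc2 := Finset.card_erase_of_mem hjJ
      have hpos : 0 < (J.erase i).card := Finset.card_pos.2 ⟨j, hjJ⟩
      obtain ⟨Q, U, hQ, hU, hcov, hsh⟩ := ih ((J.erase i).erase j)
        ((Finset.erase_ssubset hjJ).trans (Finset.erase_ssubset hi))
      obtain ⟨g, hg⟩ : (sharedPairs χ r i j).Nonempty := Finset.card_pos.1 (by omega)
      obtain ⟨u, v, -, h1, h2⟩ := (Finset.mem_filter.1 hg).2
      -- One common pair serves both removed colors, so two vertices pay for two colors.
      refine ⟨Q, U ∪ {u, v}, hQ.trans ((Finset.erase_subset _ _).trans (Finset.erase_subset _ _)),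
        ?_, ?_, hsh⟩
      · have h3 := Finset.card_union_le U {u, v}
        have h4 := Finset.card_le_two (a := u) (b := v)
        omega
      · intro l hl hlQ
        by_cases hli : l = i
        · exact ⟨u, by simp, v, by simp, hli ▸ h1⟩
        by_cases hlj : l = j
        · exact ⟨u, by simp, v, by simp, hlj ▸ h2⟩
        obtain ⟨a, ha, b, hb, hab⟩ := hcov l (by simp [hl, hli, hlj]) hlQ
        exact ⟨a, by simp [ha], b, by simp [hb], hab⟩
    · push Not at hJ
      exact ⟨J, ∅, subset_rfl, by simp, fun i hi hi' => absurd hi hi', hJ⟩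

end Counting

/-! ### The cases with a single remaining color. -/

section SingleColor

variable {V ι : Type*} [Fintype V] [DecidableEq V] [DecidableEq ι]

open Classical in
/-- If nearly all `r`-sets containing a fixed `(r - 2)`-set have color `i`, then that color has a
Hamiltonian Berge-cycle. -/
theorem hasHamBerge_of_sunflower {χ : Finset V → ι} {r : ℕ} (hr : 5 ≤ r) {i : ι} {S Z : Finset V}
    (hS : S.card + 2 = r) (hZ : 2 * r + 2 * Z.card + 6 ≤ Fintype.card V)
    (h : ∀ x y, x ∉ S → y ∉ S → x ≠ y → y ∉ Z → χ (insert x (insert y S)) = i) :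
    HasHamBerge χ r i := by
  -- Only pairs inside `Z \ S` are excluded. Nonadjacent vertices have degree at least `n - Z.card`,
  -- so no pair of a saturated graph can stay nonadjacent.
  let Γ : SimpleGraph V :=
    { Adj := fun x y => x ≠ y ∧ (x ∈ S ∨ y ∈ S ∨ x ∉ Z ∨ y ∉ Z)
      symm := ⟨fun x y hxy => ⟨hxy.1.symm, by tauto⟩⟩
      loopless := ⟨fun x hx => hx.1 rfl⟩ }
  have hΓ : ∃ c, IsHamCycle Γ.Adj c := by
    by_contra hcon
    obtain ⟨G, hG, -, ⟨u, v, -, -, huv, hadj⟩, hsat⟩ := exists_saturated Γ (∅ : Set V) (by omega) hcon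
      (fun G hG hcl => isHamCycle_of_clique_detours (E := ∅) (Y := fun p => p.1) (by simp) (by simp)
        (by simpa using hcl) (by simp) (by simp; omega))
    have hs := hsat u v (by simp) (by simp) huv hadj
    have hdeg : ∀ a b, a ≠ b → ¬ G.Adj a b → Fintype.card V ≤ G.degree a + Z.card := by
      intro a b hab hadj
      have hsub : (Finset.univ : Finset V) ⊆ G.neighborFinset a ∪ Z := by
        intro w _
        rw [Finset.mem_union, SimpleGraph.mem_neighborFinset]
        by_contra hw
        rw [not_or] at hw
        have haZ : a ∈ Z := by
          by_contra haZ
          exact hadj (hG ⟨hab, by tauto⟩)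
        exact hw.1 (hG ⟨fun h => hw.2 (h ▸ haZ), by tauto⟩)
      have h1 := Finset.card_le_card hsub
      have h2 := Finset.card_union_le (G.neighborFinset a) Z
      rw [SimpleGraph.card_neighborFinset_eq_degree] at h2
      rw [Finset.card_univ] at h1
      omega
    have h1 := hdeg u v huv hadj
    have h2 := hdeg v u huv.symm fun h => hadj h.symm
    omega
  obtain ⟨c, hc⟩ := hΓ
  obtain ⟨v, hv, hadj⟩ := exists_fin_of_isHamCycle hc
  have hvs : Function.Surjective v :=
    ((Fintype.bijective_iff_injective_and_card v).2 ⟨hv, by simp⟩).2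
  have hss : Function.Surjective (cyclicSucc : Fin (Fintype.card V) → Fin (Fintype.card V)) :=
    Finite.surjective_of_injective cyclicSucc_injective
  -- A consecutive pair that misses `S` has only one edge containing it and `S`, which is
  -- prescribed. Pairs that meet `S` have many candidates and are left to Hall's theorem.
  let B : Finset (Fin (Fintype.card V)) :=
    Finset.univ.filter fun j => v j ∉ S ∧ v (cyclicSucc j) ∉ S
  let g : Fin (Fintype.card V) → Finset V := fun j => insert (v j) (insert (v (cyclicSucc j)) S)
  have hvne : ∀ j, v j ≠ v (cyclicSucc j) := fun j => (hadj j).1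
  have hmemB : ∀ j, j ∈ B ↔ v j ∉ S ∧ v (cyclicSucc j) ∉ S := by simp [B]
  have hmemg : ∀ j x, x ∈ g j ↔ x = v j ∨ x = v (cyclicSucc j) ∨ x ∈ S := by simp [g]
  have H := exists_representatives (χ := χ) (r := r) (i := i) (by omega) hv B g ?_ ?_ ?_
  · obtain ⟨e, he, het⟩ := H
    exact ⟨v, e, hv, he, het⟩
  · intro j hj k hk hjk
    rw [Finset.mem_coe, hmemB] at hj
    have h1 : v j ∈ g k := by
      rw [← hjk, hmemg]; tauto
    have h2 : v (cyclicSucc j) ∈ g k := by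
      rw [← hjk, hmemg]; tauto
    rw [hmemg] at h1 h2
    have h3 := hvne j
    apply consecutive_pair_injective (by omega) hv
    rw [Sym2.eq_iff]
    rcases h1 with h1 | h1 | h1
    · rcases h2 with h2 | h2 | h2
      · exact absurd (h1.trans h2.symm) h3
      · exact Or.inl ⟨h1, h2⟩
      · exact absurd h2 hj.2
    · rcases h2 with h2 | h2 | h2
      · exact Or.inr ⟨h1, h2⟩
      · exact absurd (h1.trans h2.symm) h3
      · exact absurd h2 hj.2
    · exact absurd h1 hj.1
  · intro j hj
    rw [hmemB] at hj
    have hZj := (hadj j).2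
    refine mem_edgesThrough.2 ⟨?_, ?_, by rw [hmemg]; tauto, by rw [hmemg]; tauto⟩
    · simp only [g]
      rw [Finset.card_insert_of_notMem, Finset.card_insert_of_notMem hj.2, hS]
      simp [hvne j, hj.1]
    · by_cases hsj : v (cyclicSucc j) ∈ Z
      · simp only [g]
        rw [Finset.insert_comm]
        exact h _ _ hj.2 hj.1 (hvne j).symm (by tauto)
      · exact h _ _ hj.1 hj.2 (hvne j) hsj
  · intro j hj
    rw [hmemB] at hj
    obtain ⟨w, hwS, hw1, hw2⟩ : ∃ w, w ∉ S ∧ v j ∈ insert w S ∧ v (cyclicSucc j) ∈ insert w S := by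
      by_cases h1 : v j ∈ S
      · by_cases h2 : v (cyclicSucc j) ∈ S
        · obtain ⟨w, -, hw⟩ := Finset.exists_mem_notMem_of_card_lt_card (s := S)
            (t := (Finset.univ : Finset V)) (by rw [Finset.card_univ]; omega)
          exact ⟨w, hw, by simp [h1], by simp [h2]⟩
        · exact ⟨_, h2, by simp [h1], by simp⟩
      · have h2 : v (cyclicSucc j) ∈ S := by tauto
        exact ⟨_, h1, by simp, by simp [h2]⟩
    obtain ⟨k₁, hk₁⟩ := hvs w
    obtain ⟨k₂, hk₂⟩ := hss k₁
    -- A prescribed edge contains `w` only if its pair does. Excluding the two cycle neighbors of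
    -- `w` keeps the candidates `insert w (insert z S)` distinct from all prescribed edges.
    let T : Finset V := Finset.univ \ ((S ∪ Z) ∪ {w, v (cyclicSucc k₁), v k₂})
    have hT : r ≤ T.card := by
      have h1 := Finset.le_card_sdiff ((S ∪ Z) ∪ {w, v (cyclicSucc k₁), v k₂}) Finset.univ
      have h2 := Finset.card_union_le (S ∪ Z) {w, v (cyclicSucc k₁), v k₂}
      have h3 := Finset.card_union_le S Z
      have h4 := Finset.card_le_three (a := w) (b := v (cyclicSucc k₁)) (c := v k₂)
      rw [Finset.card_univ] at h1
      simp only [T]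
      omega
    have hTm : ∀ z ∈ T, z ∉ S ∧ z ∉ Z ∧ z ≠ w ∧ z ≠ v (cyclicSucc k₁) ∧ z ≠ v k₂ := by
      intro z hz
      simp only [T, Finset.mem_sdiff, Finset.mem_union, Finset.mem_insert, Finset.mem_singleton,
        not_or] at hz
      tauto
    refine hT.trans (Finset.card_le_card_of_injOn (fun z => insert w (insert z S)) ?_ ?_)
    · intro z hz
      obtain ⟨h1, h2, h3, h4, h5⟩ := hTm z hz
      rw [Finset.mem_coe, Finset.mem_sdiff]
      have hsub : insert w S ⊆ insert w (insert z S) :=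
        Finset.insert_subset_insert _ (Finset.subset_insert _ _)
      refine ⟨mem_edgesThrough.2 ⟨?_, h w z hwS h1 h3.symm h2, hsub hw1, hsub hw2⟩, ?_⟩
      · rw [Finset.card_insert_of_notMem, Finset.card_insert_of_notMem h1, hS]
        simp [h3.symm, hwS]
      · intro hmem
        obtain ⟨k, hk, hgk⟩ := Finset.mem_image.1 hmem
        have hwk : w ∈ g k := by rw [hgk]; simp
        have hzk : z ∈ g k := by rw [hgk]; simp
        rw [hmemg] at hwk hzk
        rcases hwk with a | a | a
        · have : k = k₁ := hv (by rw [hk₁, a])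
          subst this
          rcases hzk with b | b | b
          · exact h3 (b.trans a.symm)
          · exact h4 b
          · exact h1 b
        · have : k = k₂ := cyclicSucc_injective (hv (by rw [hk₂, hk₁, a]))
          subst this
          rcases hzk with b | b | b
          · exact h5 b
          · exact h3 (b.trans a.symm)
          · exact h1 b
        · exact hwS a
    · intro z hz z' hz' hzz
      have : z ∈ insert w (insert z' S) := by
        simp only at hzz
        rw [← hzz]; simp
      obtain ⟨h1, -, h3, -⟩ := hTm z hz
      simp only [Finset.mem_insert] at this
      tauto

variable [Fintype ι]

/-- A single unmatched color is impossible when two further colors share many pairs. -/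
theorem false_of_one_unmatched {χ : Finset V → ι} {r : ℕ} (hr : 5 ≤ r)
    (hι : Fintype.card ι = r - 1) (hV : 200 * r ^ 4 < Fintype.card V) {I : Finset ι}
    {b : ι → V} {Z : Finset V} (hI : ∀ i ∈ I, ∀ x, x ∉ Z → edgesThrough χ r i (b i) x = ∅)
    (hZ : Z.card ≤ 60 * r ^ 3) {W : Finset V} (hbW : ∀ i ∈ I, b i ∈ W) (hW : W.card + 4 ≤ r)
    {i₁ i₂ i₃ : ι} (hs : 2 * r ≤ (sharedPairs χ r i₁ i₂).card)
    (hcov : ∀ i, i ∉ I → i ≠ i₁ → i ≠ i₂ → i ≠ i₃ → ∃ u ∈ W, ∃ v ∈ W, v ∈ nbr χ r i u)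
    {N : Finset V} (hN : 2 * N.card < Fintype.card V)
    (hN' : ∀ v, v ∉ N → 11 * r ≤ (nbr χ r i₃ v).card) : False := by
  have hr3 : 5 * r ^ 3 ≤ r ^ 4 := by
    rw [show r ^ 4 = r * r ^ 3 by ring]
    exact Nat.mul_le_mul_right _ hr
  have hr1 : 25 * r ≤ r ^ 3 := by
    rw [show r ^ 3 = r ^ 2 * r by ring]
    exact Nat.mul_le_mul_right _ (Nat.pow_le_pow_left hr 2)
  obtain ⟨Gs, hGs, hGc⟩ := Finset.exists_subset_card_eq hs
  have hpair : ∀ g ∈ Gs, g.card ≤ 2 ∧ (∃ u ∈ g, ∃ v ∈ g, v ∈ nbr χ r i₁ u) ∧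
      ∃ u ∈ g, ∃ v ∈ g, v ∈ nbr χ r i₂ u := by
    intro g hg
    obtain ⟨u, v, rfl, h1, h2⟩ := (Finset.mem_filter.1 (hGs hg)).2
    exact ⟨Finset.card_le_two, ⟨u, by simp, v, by simp, h1⟩, ⟨u, by simp, v, by simp, h2⟩⟩
  have hcov' : ∀ g ∈ Gs, ∀ i, i ∉ I → i ≠ i₃ → ∃ u ∈ W ∪ g, ∃ v ∈ W ∪ g, v ∈ nbr χ r i u := by
    intro g hg i hi h3
    obtain ⟨-, ⟨u, hu, v, hv, huv⟩, ⟨u', hu', v', hv', huv'⟩⟩ := hpair g hg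
    by_cases h1 : i = i₁
    · exact ⟨u, by simp [hu], v, by simp [hv], h1 ▸ huv⟩
    by_cases h2 : i = i₂
    · exact ⟨u', by simp [hu'], v', by simp [hv'], h2 ▸ huv'⟩
    obtain ⟨u, hu, v, hv, huv⟩ := hcov i hi h1 h2 h3
    exact ⟨u, by simp [hu], v, by simp [hv], huv⟩
  -- If some common pair `g` saves a vertex, there is room for a center `s` with sparse partners for
  -- `i₃`. Taking `i₁` as second open color is harmless, since `g` already covers it.
  by_cases hsmall : ∃ g ∈ Gs, (W ∪ g).card + 3 ≤ r
  · obtain ⟨g, hg, hgW⟩ := hsmall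
    obtain ⟨s, -, hsm⟩ := Finset.exists_mem_notMem_of_card_lt_card (s := Z ∪ N)
      (t := (Finset.univ : Finset V)) (by
        have := Finset.card_union_le Z N
        rw [Finset.card_univ]; omega)
    rw [Finset.mem_union, not_or] at hsm
    have hsub : W ∪ g ⊆ insert s (W ∪ g) := Finset.subset_insert _ _
    have hIs : ∀ i, i ∉ I → i ≠ i₃ →
        ∃ u ∈ insert s (W ∪ g), ∃ v ∈ insert s (W ∪ g), v ∈ nbr χ r i u := by
      intro i hi hi3
      obtain ⟨u, hu, v, hv, huv⟩ := hcov' g hg i hi hi3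
      exact ⟨u, hsub hu, v, hsub hv, huv⟩
    obtain ⟨-, ⟨u, hu, v, hv, huv⟩, -⟩ := hpair g hg
    refine false_of_two_free_of_le (χ := χ) hr hι (W := insert s (W ∪ g)) (X := nbr χ r i₃ s)
      (Y := Finset.univ) ?_ (hN' s hsm.2) (by rw [Finset.card_univ]; omega) i₃ i₁ ?_ ?_ ?_
    · have := Finset.card_insert_le s (W ∪ g); omega
    · exact fun x hx => ⟨s, by simp, x, by simp, hx⟩
    · exact fun y _ => ⟨u, by simp [hu], v, by simp [hv], huv⟩
    · intro i h3 _
      by_cases hi : i ∈ I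
      · exact Or.inr fun x hx => ⟨b i, by simp [hbW i hi], s, by simp, hI i hi s hsm.1⟩
      · exact Or.inl (hIs i hi h3)
  · push Not at hsmall
    have hWg : ∀ g ∈ Gs, (W ∪ g).card + 2 = r ∧ Disjoint W g := by
      intro g hg
      have h1 := hsmall g hg
      have h2 := Finset.card_union_le W g
      have h3 := (hpair g hg).1
      refine ⟨by omega, ?_⟩
      rw [← Finset.card_union_eq_card_add_card]
      omega
    set Γ := Gs.biUnion id with hΓ
    have hΓc : Γ.card ≤ 4 * r := by
      have : Γ.card ≤ Gs.card * 2 := Finset.card_biUnion_le_card_mul _ _ _ fun g hg => (hpair g hg).1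
      omega
    -- Otherwise every `W ∪ g` has exactly `r - 2` vertices. Edges through it in colors outside `I`
    -- other than `i₃` are few, so a generic `s` avoids them all. Then every `W ∪ g ∪ {s, x}` has
    -- color `i₃`, giving `2 * r` edges through the pair `s`, `x`, which is sparse for `i₃`.
    set bad : Finset (Finset V) := Gs.biUnion fun g =>
      (Finset.univ.filter fun i => i ∉ I ∧ i ≠ i₃).biUnion fun i =>
        Finset.univ.filter fun e => e.card = r ∧ χ e = i ∧ W ∪ g ⊆ e with hbad
    have hbadc : bad.card ≤ 4 * r ^ 3 := by
      have h1 : bad.card ≤ Gs.card * ((r - 1) * (2 * r)) := by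
        refine Finset.card_biUnion_le_card_mul _ _ _ fun g hg => ?_
        refine (Finset.card_biUnion_le_card_mul _ _ (2 * r) fun i hi => ?_).trans ?_
        · simp only [Finset.mem_filter, Finset.mem_univ, true_and] at hi
          obtain ⟨u, hu, v, hv, huv⟩ := hcov' g hg i hi.1 hi.2
          apply card_image_insert_le huv _ id (Set.injOn_id _)
          intro e he
          simp only [Finset.mem_filter, Finset.mem_univ, true_and] at he
          exact ⟨he.1, he.2.1, he.2.2 hu, he.2.2 hv⟩
        · refine Nat.mul_le_mul_right _ ?_
          rw [← hι, ← Finset.card_univ]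
          exact Finset.card_filter_le _ _
      rw [hGc] at h1
      have h2 : 2 * r * ((r - 1) * (2 * r)) ≤ 2 * r * (r * (2 * r)) := by gcongr; omega
      have h3 : 2 * r * (r * (2 * r)) = 4 * r ^ 3 := by ring
      omega
    have hbadV : (bad.biUnion id).card ≤ 4 * r ^ 4 := by
      have h1 : (bad.biUnion id).card ≤ bad.card * r := by
        refine Finset.card_biUnion_le_card_mul _ _ _ fun e he => ?_
        simp only [hbad, Finset.mem_biUnion, Finset.mem_filter] at he
        obtain ⟨g, -, i, -, -, he, -⟩ := he
        exact he.le
      have h2 := Nat.mul_le_mul_right r hbadc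
      have h3 : 4 * r ^ 3 * r = 4 * r ^ 4 := by ring
      omega
    obtain ⟨s, -, hsm⟩ := Finset.exists_mem_notMem_of_card_lt_card
      (s := (((Z ∪ N) ∪ W) ∪ Γ) ∪ bad.biUnion id) (t := (Finset.univ : Finset V)) (by
        have h1 := Finset.card_union_le Z N
        have h2 := Finset.card_union_le (Z ∪ N) W
        have h3 := Finset.card_union_le ((Z ∪ N) ∪ W) Γ
        have h4 := Finset.card_union_le (((Z ∪ N) ∪ W) ∪ Γ) (bad.biUnion id)
        rw [Finset.card_univ]; omega)
    simp only [Finset.mem_union, not_or] at hsm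
    obtain ⟨⟨⟨⟨hsZ, hsN⟩, hsW⟩, hsΓ⟩, hsb⟩ := hsm
    obtain ⟨x, hx, hxm⟩ := Finset.exists_mem_notMem_of_card_lt_card (s := W ∪ Γ)
      (t := nbr χ r i₃ s) (by
        have h1 := Finset.card_union_le W Γ
        have h2 := hN' s hsN
        omega)
    simp only [Finset.mem_union, not_or] at hxm
    have hgΓ : ∀ g ∈ Gs, ∀ z ∈ g, z ∈ Γ := fun g hg z hz => Finset.mem_biUnion.2 ⟨g, hg, hz⟩
    have hsx := (mem_nbr.1 hx).1
    have hlt := (mem_nbr.1 hx).2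
    rw [← hGc] at hlt
    refine absurd hlt (not_lt.2 ?_)
    refine Finset.card_le_card_of_injOn (fun g => insert s (insert x (W ∪ g))) ?_ ?_
    · intro g hg
      have hg : g ∈ Gs := hg
      have hxg : x ∉ W ∪ g := by
        rw [Finset.mem_union, not_or]
        exact ⟨hxm.1, fun h => hxm.2 (hgΓ g hg x h)⟩
      have hsg : s ∉ insert x (W ∪ g) := by
        rw [Finset.mem_insert, Finset.mem_union, not_or, not_or]
        exact ⟨hsx, hsW, fun h => hsΓ (hgΓ g hg s h)⟩
      have hcard : (insert s (insert x (W ∪ g))).card = r := by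
        rw [Finset.card_insert_of_notMem hsg, Finset.card_insert_of_notMem hxg]
        exact (hWg g hg).1
      have hWe : W ∪ g ⊆ insert s (insert x (W ∪ g)) :=
        (Finset.subset_insert _ _).trans (Finset.subset_insert _ _)
      refine mem_edgesThrough.2 ⟨hcard, ?_, by simp, by simp⟩
      by_contra hne
      by_cases hi : χ (insert s (insert x (W ∪ g))) ∈ I
      · have h1 := hI _ hi s hsZ
        have h2 : insert s (insert x (W ∪ g)) ∈
            edgesThrough χ r (χ (insert s (insert x (W ∪ g))))
              (b (χ (insert s (insert x (W ∪ g))))) s :=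
          mem_edgesThrough.2 ⟨hcard, rfl, hWe (Finset.mem_union_left _ (hbW _ hi)), by simp⟩
        rw [h1] at h2
        simp at h2
      · apply hsb
        refine Finset.mem_biUnion.2 ⟨insert s (insert x (W ∪ g)), ?_, by simp⟩
        refine Finset.mem_biUnion.2 ⟨g, hg, Finset.mem_biUnion.2
          ⟨χ (insert s (insert x (W ∪ g))), ?_, ?_⟩⟩
        · simp only [Finset.mem_filter, Finset.mem_univ, true_and]
          exact ⟨hi, hne⟩
        · simp only [Finset.mem_filter, Finset.mem_univ, true_and]
          exact ⟨hcard, hWe⟩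
    · have key : ∀ g ∈ Gs, ∀ g' ∈ Gs,
          insert s (insert x (W ∪ g)) = insert s (insert x (W ∪ g')) → g ⊆ g' := by
        intro g hg g' hg' heq z hz
        have hzm : z ∈ insert s (insert x (W ∪ g')) := by
          rw [← heq]; simp [hz]
        simp only [Finset.mem_insert, Finset.mem_union] at hzm
        have hzΓ := hgΓ g hg z hz
        rcases hzm with h | h | h | h
        · exact absurd (h ▸ hzΓ) hsΓ
        · exact absurd (h ▸ hzΓ) hxm.2
        · exact absurd hz (Finset.disjoint_left.1 (hWg g hg).2 h)
        · exact h
      intro g hg g' hg' heq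
      exact Finset.Subset.antisymm (key g hg g' hg' heq) (key g' hg' g hg heq.symm)

end SingleColor

/-! ### A sparse pair at which the other colors are ordinary. -/

section Center

variable {V ι : Type*} [Fintype V] [DecidableEq V] [DecidableEq ι]

omit [DecidableEq ι] [Fintype V] in
theorem card_add_card_le {D : ι → Finset V} {r : ℕ} {i j : ι} (h : (D i ∩ D j).card < 2 * r) :
    (D i).card + (D j).card ≤ (D i ∪ D j).card + 2 * r := by
  have := Finset.card_union_add_card_inter (D i) (D j)
  omega

omit [DecidableEq ι] in
theorem card_add_card_add_card_le {D : ι → Finset V} {r : ℕ} {i j l : ι}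
    (hij : (D i ∩ D j).card < 2 * r) (hil : (D i ∩ D l).card < 2 * r)
    (hjl : (D j ∩ D l).card < 2 * r) :
    (D i).card + (D j).card + (D l).card ≤ Fintype.card V + 6 * r := by
  have h1 := Finset.card_union_add_card_inter (D i) (D j)
  have h2 := Finset.card_union_add_card_inter (D i ∪ D j) (D l)
  rw [Finset.union_inter_distrib_right] at h2
  have h3 := Finset.card_union_le (D i ∩ D l) (D j ∩ D l)
  have h4 := Finset.card_le_univ (D i ∪ D j ∪ D l)
  omega

/-- If no two colors have nearly half-sized parameters, some vertex in one of the sets `A i` is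
exceptional for at most one further color. -/
theorem exists_center_of_small {χ : Finset V → ι} {r : ℕ} (hr : 5 ≤ r)
    (hV : 200 * r ^ 4 < Fintype.card V) {Q : Finset ι} (hQ : Q.Nonempty) {k : ι → ℕ}
    {A N : ι → Finset V} (hC : ∀ i ∈ Q, IsChvatal χ r i (k i) (A i) (N i))
    (hsh : ∀ s, ∀ i ∈ Q, ∀ j ∈ Q, i ≠ j → (nbr χ r i s ∩ nbr χ r j s).card < 2 * r)
    {O : Finset V} (hO : O.card ≤ 60 * r ^ 3)
    (hk : ∀ i ∈ Q, ∀ j ∈ Q, i ≠ j → k i + k j + 60 * r ^ 3 + 66 * r + 1 < Fintype.card V) :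
    ∃ i ∈ Q, ∃ s, ∃ x ∈ nbr χ r i s, x ∉ O ∧ ∀ j ∈ Q, j ≠ i → s ∉ N j ∨ x ∉ N j := by
  have hr3 : 5 * r ^ 3 ≤ r ^ 4 := by
    rw [show r ^ 4 = r * r ^ 3 by ring]
    exact Nat.mul_le_mul_right _ hr
  have hr1 : 25 * r ≤ r ^ 3 := by
    rw [show r ^ 3 = r ^ 2 * r by ring]
    exact Nat.mul_le_mul_right _ (Nat.pow_le_pow_left hr 2)
  -- A common vertex would have sparse degrees adding up to more than `n + 2 * r`.
  have hdisj : (Q : Set ι).PairwiseDisjoint A := by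
    intro i hi j hj hij
    change Disjoint (A i) (A j)
    rw [Finset.disjoint_left]
    intro a hai haj
    have h1 := (hC i hi).le_nbr_of_mem a hai
    have h2 := (hC j hj).le_nbr_of_mem a haj
    have h3 := card_add_card_le (D := fun i => nbr χ r i a) (hsh a i hi j hj hij)
    have h4 := Finset.card_le_univ (nbr χ r i a ∪ nbr χ r j a)
    have h5 := hk i hi j hj hij
    omega
  -- Averaging: the sets `N j` have total size at most that of the disjoint sets `A j`, so the
  -- vertices of the union lie in at most one `N j` on average.
  obtain ⟨s, hs, hsN⟩ : ∃ s ∈ Q.biUnion A, (Q.filter fun j => s ∈ N j).card ≤ 1 := by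
    by_contra hcon
    push Not at hcon
    have h1 : (Q.biUnion A).card * 2 ≤ ∑ s ∈ Q.biUnion A, (Q.filter fun j => s ∈ N j).card := by
      rw [← smul_eq_mul, ← Finset.sum_const]
      exact Finset.sum_le_sum fun s hs => hcon s hs
    have h2 : ∑ s ∈ Q.biUnion A, (Q.filter fun j => s ∈ N j).card =
        ∑ j ∈ Q, ((Q.biUnion A).filter fun s => s ∈ N j).card :=
      Finset.sum_card_bipartiteAbove_eq_sum_card_bipartiteBelow (fun s j => s ∈ N j)
    have h3 : ∑ j ∈ Q, ((Q.biUnion A).filter fun s => s ∈ N j).card ≤ ∑ j ∈ Q, (A j).card := by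
      refine Finset.sum_le_sum fun j hj => ?_
      refine le_trans (Finset.card_le_card ?_) ((hC j hj).card_le.trans (hC j hj).le_card)
      intro s hs
      exact (Finset.mem_filter.1 hs).2
    rw [← Finset.card_biUnion hdisj] at h3
    obtain ⟨i, hi⟩ := hQ
    have h4 := Finset.card_le_card (Finset.subset_biUnion_of_mem A hi)
    have h5 := (hC i hi).le_card
    have h6 := (hC i hi).le_k
    omega
  obtain ⟨i, hi, hsi⟩ := Finset.mem_biUnion.1 hs
  have hdeg := (hC i hi).le_nbr_of_mem s hsi
  have hki := (hC i hi).two_mul_lt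
  set M := (Q.filter fun j => s ∈ N j ∧ j ≠ i) with hM
  have hM1 : M.card ≤ 1 := by
    refine le_trans (Finset.card_le_card ?_) hsN
    intro j hj
    simp only [hM, Finset.mem_filter] at hj ⊢
    tauto
  have hbound : (O ∪ M.biUnion N).card < (nbr χ r i s).card := by
    have h1 := Finset.card_union_le O (M.biUnion N)
    have : Nonempty ι := ⟨i⟩
    rcases Finset.card_le_one_iff_subset_singleton.1 hM1 with ⟨j, hj⟩
    rcases Finset.subset_singleton_iff.1 hj with h | h
    · rw [h] at h1 ⊢
      simp only [Finset.biUnion_empty, Finset.card_empty] at h1 ⊢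
      omega
    · rw [h] at h1 ⊢
      rw [Finset.singleton_biUnion] at h1 ⊢
      have hjM : j ∈ M := by rw [h]; simp
      simp only [hM, Finset.mem_filter] at hjM
      have h2 := hk i hi j hjM.1 hjM.2.2.symm
      have h3 := (hC j hjM.1).card_le
      omega
  obtain ⟨x, hx, hxm⟩ := Finset.exists_mem_notMem_of_card_lt_card hbound
  rw [Finset.mem_union, not_or] at hxm
  refine ⟨i, hi, s, x, hx, hxm.1, ?_⟩
  intro j hj hji
  by_cases hsj : s ∈ N j
  · right
    intro hxj
    exact hxm.2 (Finset.mem_biUnion.2 ⟨j, by simp [hM, hj, hsj, hji], hxj⟩)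
  · exact Or.inl hsj

/-- The case of two colors whose parameters are nearly half of the number of vertices. -/
theorem exists_center_of_large {χ : Finset V → ι} {r : ℕ} (hr : 5 ≤ r)
    (hV : 200 * r ^ 4 < Fintype.card V) {Q : Finset ι} (hQr : Q.card < r) {k : ι → ℕ}
    {A N : ι → Finset V} (hC : ∀ i ∈ Q, IsChvatal χ r i (k i) (A i) (N i))
    (hsh : ∀ s, ∀ i ∈ Q, ∀ j ∈ Q, i ≠ j → (nbr χ r i s ∩ nbr χ r j s).card < 2 * r)
    {O : Finset V} (hO : O.card ≤ 60 * r ^ 3) {i₁ i₂ : ι} (h₁ : i₁ ∈ Q) (h₂ : i₂ ∈ Q)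
    (h₁₂ : i₁ ≠ i₂) (hk : Fintype.card V ≤ k i₁ + k i₂ + 60 * r ^ 3 + 66 * r + 1) :
    ∃ i ∈ Q, ∃ s, ∃ x ∈ nbr χ r i s, x ∉ O ∧ ∀ j ∈ Q, j ≠ i → s ∉ N j ∨ x ∉ N j := by
  have hr3 : 5 * r ^ 3 ≤ r ^ 4 := by
    rw [show r ^ 4 = r * r ^ 3 by ring]
    exact Nat.mul_le_mul_right _ hr
  have hr1 : 25 * r ≤ r ^ 3 := by
    rw [show r ^ 3 = r ^ 2 * r by ring]
    exact Nat.mul_le_mul_right _ (Nat.pow_le_pow_left hr 2)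
  set n := Fintype.card V with hn
  have hC₁ := hC i₁ h₁
  have hC₂ := hC i₂ h₂
  have hk₁ := hC₁.two_mul_lt
  have hk₂ := hC₂.two_mul_lt
  have hN₁ := hC₁.card_le
  have hN₂ := hC₂.card_le
  have hN₁₂ := Finset.card_union_le (N i₁) (N i₂)
  set heavy := Q.filter fun j => j ≠ i₁ ∧ j ≠ i₂ ∧ 60 * r ^ 3 + 270 * r + 1 < k j with hheavy
  set light := Q.filter fun j => j ≠ i₁ ∧ j ≠ i₂ ∧ k j ≤ 60 * r ^ 3 + 270 * r + 1 with hlight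
  have hmh : ∀ j ∈ heavy, j ∈ Q ∧ j ≠ i₁ ∧ j ≠ i₂ ∧ 60 * r ^ 3 + 270 * r + 1 < k j := by
    intro j hj
    simpa [hheavy] using hj
  -- vertices that are ordinary for `i₁` and `i₂` are exceptional for a heavy color
  have hsub : ∀ j ∈ heavy, Finset.univ \ (N i₁ ∪ N i₂) ⊆ N j := by
    intro j hj w hw
    obtain ⟨hjQ, hj1, hj2, hkj⟩ := hmh j hj
    simp only [Finset.mem_sdiff, Finset.mem_univ, true_and, Finset.mem_union, not_or] at hw
    by_contra hwj
    have a := hC₁.le_nbr_of_notMem w hw.1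
    have b := hC₂.le_nbr_of_notMem w hw.2
    have c := (hC j hjQ).le_nbr_of_notMem w hwj
    have d := card_add_card_add_card_le (D := fun i => nbr χ r i w) (hsh w i₁ h₁ i₂ h₂ h₁₂)
      (hsh w i₁ h₁ j hjQ hj1.symm) (hsh w i₂ h₂ j hjQ hj2.symm)
    omega
  -- If `k j` were far from `n / 2`, every vertex of `A j` would be exceptional for `i₁` and `i₂`.
  -- Then `N j`, which contains the complement of `N i₁ ∪ N i₂`, would have at least `n - k i₁ - k
  -- i₂ + k j > k j` vertices.
  have hhalf : ∀ j ∈ heavy, n ≤ 2 * k j + 120 * r ^ 3 + 408 * r + 2 := by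
    intro j hj
    obtain ⟨hjQ, hj1, hj2, hkj⟩ := hmh j hj
    by_contra hcon
    have hA : A j ⊆ N i₁ ∩ N i₂ := by
      intro a ha
      have c := (hC j hjQ).le_nbr_of_mem a ha
      rw [Finset.mem_inter]
      constructor
      · by_contra haN
        have h3 := hC₁.le_nbr_of_notMem a haN
        have h4 := card_add_card_le (D := fun i => nbr χ r i a) (hsh a i₁ h₁ j hjQ hj1.symm)
        have h5 := Finset.card_le_univ (nbr χ r i₁ a ∪ nbr χ r j a)
        omega
      · by_contra haN
        have h3 := hC₂.le_nbr_of_notMem a haN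
        have h4 := card_add_card_le (D := fun i => nbr χ r i a) (hsh a i₂ h₂ j hjQ hj2.symm)
        have h5 := Finset.card_le_univ (nbr χ r i₂ a ∪ nbr χ r j a)
        omega
    have h3 := Finset.card_le_card hA
    have h4 := Finset.card_le_card (hsub j hj)
    have h5 := Finset.le_card_sdiff (N i₁ ∪ N i₂) Finset.univ
    rw [Finset.card_univ] at h5
    have h6 := Finset.card_union_add_card_inter (N i₁) (N i₂)
    have h7 := (hC j hjQ).le_card
    have h8 := (hC j hjQ).card_le
    omega
  -- With four parameters near `n / 2`, a vertex is ordinary for at most two of the four colors. The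
  -- four sets `N t` would cover every vertex twice, although each has fewer than `n / 2` elements.
  have hheavy1 : heavy.card ≤ 1 := by
    by_contra hcon
    obtain ⟨j, hj, l, hl, hjl⟩ := Finset.one_lt_card.1 (not_le.1 hcon)
    obtain ⟨hjQ, hj1, hj2, -⟩ := hmh j hj
    obtain ⟨hlQ, hl1, hl2, -⟩ := hmh l hl
    set T : Finset ι := {i₁, i₂, j, l} with hT
    have hTQ : ∀ t ∈ T, t ∈ Q ∧ n ≤ 2 * k t + 120 * r ^ 3 + 408 * r + 2 := by
      intro t ht
      simp only [hT, Finset.mem_insert, Finset.mem_singleton] at ht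
      rcases ht with rfl | rfl | rfl | rfl
      · exact ⟨h₁, by omega⟩
      · exact ⟨h₂, by omega⟩
      · exact ⟨hjQ, hhalf _ hj⟩
      · exact ⟨hlQ, hhalf _ hl⟩
    have hTc : T.card = 4 := by
      rw [hT, Finset.card_insert_of_notMem, Finset.card_insert_of_notMem, Finset.card_pair hjl]
      · simp [hj2.symm, hl2.symm]
      · simp [h₁₂, hj1.symm, hl1.symm]
    have hw : ∀ w, 2 ≤ (T.filter fun t => w ∈ N t).card := by
      intro w
      have hle : (T.filter fun t => w ∉ N t).card ≤ 2 := by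
        by_contra hcon
        obtain ⟨a, b, c, ha, hb, hc, hab, hac, hbc⟩ := Finset.two_lt_card_iff.1 (not_le.1 hcon)
        rw [Finset.mem_filter] at ha hb hc
        obtain ⟨haQ, hka⟩ := hTQ a ha.1
        obtain ⟨hbQ, hkb⟩ := hTQ b hb.1
        obtain ⟨hcQ, hkc⟩ := hTQ c hc.1
        have a' := (hC a haQ).le_nbr_of_notMem w ha.2
        have b' := (hC b hbQ).le_nbr_of_notMem w hb.2
        have c' := (hC c hcQ).le_nbr_of_notMem w hc.2
        have d := card_add_card_add_card_le (D := fun i => nbr χ r i w) (hsh w a haQ b hbQ hab)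
          (hsh w a haQ c hcQ hac) (hsh w b hbQ c hcQ hbc)
        omega
      have := Finset.card_filter_add_card_filter_not (s := T) (fun t => w ∈ N t)
      omega
    have h3 : n * 2 ≤ ∑ w : V, (T.filter fun t => w ∈ N t).card := by
      rw [hn, ← Finset.card_univ, ← smul_eq_mul, ← Finset.sum_const]
      exact Finset.sum_le_sum fun w _ => hw w
    have h4 : ∑ w : V, (T.filter fun t => w ∈ N t).card =
        ∑ t ∈ T, (Finset.univ.filter fun w => w ∈ N t).card :=
      Finset.sum_card_bipartiteAbove_eq_sum_card_bipartiteBelow (fun w t => w ∈ N t)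
    have h5 : ∑ t ∈ T, (Finset.univ.filter fun w => w ∈ N t).card * 2 ≤ T.card * (n - 1) := by
      rw [← smul_eq_mul, ← Finset.sum_const]
      refine Finset.sum_le_sum fun t ht => ?_
      have h6 := (hC t (hTQ t ht).1).card_le
      have h7 := (hC t (hTQ t ht).1).two_mul_lt
      have h8 : (Finset.univ.filter fun w => w ∈ N t) = N t := by ext; simp
      rw [h8]
      omega
    rw [← Finset.sum_mul, hTc] at h5
    omega
  obtain ⟨s, -, hs⟩ := Finset.exists_mem_notMem_of_card_lt_card (s := N i₁ ∪ N i₂)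
    (t := (Finset.univ : Finset V)) (by rw [Finset.card_univ]; omega)
  rw [Finset.mem_union, not_or] at hs
  have hd₁ := hC₁.le_nbr_of_notMem s hs.1
  have hd₂ := hC₂.le_nbr_of_notMem s hs.2
  have hd := card_add_card_le (D := fun i => nbr χ r i s) (hsh s i₁ h₁ i₂ h₂ h₁₂)
  have hlightc : (light.biUnion N).card ≤ r * (60 * r ^ 3 + 270 * r + 1) := by
    refine (Finset.card_biUnion_le_card_mul light N (60 * r ^ 3 + 270 * r + 1) ?_).trans ?_
    · intro j hj
      simp only [hlight, Finset.mem_filter] at hj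
      exact (hC j hj.1).card_le.trans hj.2.2.2
    · exact Nat.mul_le_mul_right _ ((Finset.card_filter_le _ _).trans hQr.le)
  have hheavyc : 2 * (heavy.biUnion N).card ≤ n := by
    have : Nonempty ι := ⟨i₁⟩
    rcases Finset.card_le_one_iff_subset_singleton.1 hheavy1 with ⟨j, hj⟩
    rcases Finset.subset_singleton_iff.1 hj with h | h
    · rw [h]; simp
    · rw [h, Finset.singleton_biUnion]
      have hjQ : j ∈ Q := (hmh j (by rw [h]; simp)).1
      have h3 := (hC j hjQ).card_le
      have h4 := (hC j hjQ).two_mul_lt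
      omega
  -- The sparse neighborhoods of `s` for `i₁` and `i₂` together miss only `O(r ^ 3)` vertices. The
  -- light colors exclude `O(r ^ 4)` vertices, the heavy one at most half of all.
  obtain ⟨x, hx, hxm⟩ := Finset.exists_mem_notMem_of_card_lt_card
    (s := (O ∪ light.biUnion N) ∪ heavy.biUnion N) (t := nbr χ r i₁ s ∪ nbr χ r i₂ s) (by
      have h3 := Finset.card_union_le (O ∪ light.biUnion N) (heavy.biUnion N)
      have h4 := Finset.card_union_le O (light.biUnion N)
      have h5 : r * (60 * r ^ 3 + 270 * r + 1) = 60 * r ^ 4 + 270 * r ^ 2 + r := by ring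
      have h6 : 25 * r ^ 2 ≤ r ^ 4 := by
        rw [show r ^ 4 = r ^ 2 * r ^ 2 by ring]
        exact Nat.mul_le_mul_right _ (Nat.pow_le_pow_left hr 2)
      omega)
  simp only [Finset.mem_union, not_or] at hxm
  have hfin : ∀ j ∈ Q, j ≠ i₁ → j ≠ i₂ → x ∉ N j := by
    intro j hj hj1 hj2 hxj
    rcases Nat.lt_or_ge (60 * r ^ 3 + 270 * r + 1) (k j) with h | h
    · exact hxm.2 (Finset.mem_biUnion.2 ⟨j, by simp [hheavy, hj, hj1, hj2, h], hxj⟩)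
    · exact hxm.1.2 (Finset.mem_biUnion.2 ⟨j, by simp [hlight, hj, hj1, hj2, h], hxj⟩)
  rcases Finset.mem_union.1 hx with hx | hx
  · refine ⟨i₁, h₁, s, x, hx, hxm.1.1, fun j hj hj1 => ?_⟩
    by_cases hj2 : j = i₂
    · exact Or.inl (hj2 ▸ hs.2)
    · exact Or.inr (hfin j hj hj1 hj2)
  · refine ⟨i₂, h₂, s, x, hx, hxm.1.1, fun j hj hj2 => ?_⟩
    by_cases hj1 : j = i₁
    · exact Or.inl (hj1 ▸ hs.1)
    · exact Or.inr (hfin j hj hj1 hj2)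

theorem exists_center {χ : Finset V → ι} {r : ℕ} (hr : 5 ≤ r)
    (hV : 200 * r ^ 4 < Fintype.card V) {Q : Finset ι} (hQ : Q.Nonempty) (hQr : Q.card < r)
    {k : ι → ℕ} {A N : ι → Finset V} (hC : ∀ i ∈ Q, IsChvatal χ r i (k i) (A i) (N i))
    (hsh : ∀ s, ∀ i ∈ Q, ∀ j ∈ Q, i ≠ j → (nbr χ r i s ∩ nbr χ r j s).card < 2 * r)
    {O : Finset V} (hO : O.card ≤ 60 * r ^ 3) :
    ∃ i ∈ Q, ∃ s, ∃ x ∈ nbr χ r i s, x ∉ O ∧ ∀ j ∈ Q, j ≠ i → s ∉ N j ∨ x ∉ N j := by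
  by_cases h : ∃ i ∈ Q, ∃ j ∈ Q, i ≠ j ∧ Fintype.card V ≤ k i + k j + 60 * r ^ 3 + 66 * r + 1
  · obtain ⟨i, hi, j, hj, hij, hk⟩ := h
    exact exists_center_of_large hr hV hQr hC hsh hO hi hj hij hk
  · push Not at h
    exact exists_center_of_small hr hV hQ hC hsh hO h

end Center

/-! ### Assembly of the contradiction and translation to hypergraphs. -/

section Main

variable {V ι : Type*} [Fintype V] [DecidableEq V] [DecidableEq ι]

theorem IsChvatal.le_card_nbr {χ : Finset V → ι} {r : ℕ} {i : ι} {k : ℕ} {A N : Finset V}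
    (h : IsChvatal χ r i k A N) {v : V} (hv : v ∉ N) : 11 * r ≤ (nbr χ r i v).card := by
  have h1 := h.le_nbr_of_notMem v hv
  have h2 := h.le_k
  omega

variable [Fintype ι]

/-- The unmatched colors cannot be joined to a small vertex set such that two of them keep a free
vertex. -/
theorem false_of_fan {χ : Finset V → ι} {r : ℕ} (hr : 5 ≤ r)
    (hι : Fintype.card ι = r - 1) {I Q Q' : Finset ι} {b : ι → V} {Z W W' : Finset V}
    (hI : ∀ i ∈ I, ∀ x, x ∉ Z → edgesThrough χ r i (b i) x = ∅)
    (hbW : ∀ i ∈ I, b i ∈ W) (hW : W.card + Q.card + 1 ≤ r)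
    (hcov : ∀ i, i ∉ I → i ∉ Q → ∃ u ∈ W, ∃ v ∈ W, v ∈ nbr χ r i u)
    (hQ' : 2 ≤ Q'.card) (hfree : ∀ j ∈ Q', ∃ w ∈ W', 11 * r ≤ (nbr χ r j w).card)
    (hfix : ∀ j ∈ Q, j ∉ Q' → ∃ u ∈ W', ∃ v ∈ W', v ∈ nbr χ r j u)
    (hZ : ∃ w ∈ W', w ∉ Z) (hcard : W'.card + Q'.card ≤ Q.card + 1) : False := by
  obtain ⟨z, hzW, hzZ⟩ := hZ
  have : Nonempty V := ⟨z⟩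
  choose! w hw hdeg using hfree
  have hne : ∀ j ∈ Q', ∃ x, x ∈ nbr χ r j (w j) := by
    intro j hj
    apply Finset.card_pos.1
    have := hdeg j hj
    omega
  choose! x hx using hne
  obtain ⟨i₁, h₁, i₂, h₂, h₁₂⟩ := Finset.one_lt_card.1 (show 1 < Q'.card by omega)
  have h₂' : i₂ ∈ Q'.erase i₁ := Finset.mem_erase.2 ⟨h₁₂.symm, h₂⟩
  -- All colors of `Q'` but two get a leaf. The total is at most `W.card + W'.card + Q'.card - 2 ≤ r
  -- - 2` vertices, with `i₁` and `i₂` open.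
  set P := ((Q'.erase i₁).erase i₂).image x with hP
  have hPc : P.card + 2 ≤ Q'.card := by
    have h3 : P.card ≤ ((Q'.erase i₁).erase i₂).card := Finset.card_image_le
    have h4 := Finset.card_erase_of_mem h₁
    have h5 := Finset.card_erase_of_mem h₂'
    omega
  have hW' : ∀ y, y ∈ W' → y ∈ (W ∪ W') ∪ P := fun y hy => by simp [hy]
  refine false_of_two_free_of_le (χ := χ) hr hι (W := (W ∪ W') ∪ P) (X := nbr χ r i₁ (w i₁))
    (Y := nbr χ r i₂ (w i₂)) ?_ (hdeg i₁ h₁) (hdeg i₂ h₂) i₁ i₂ ?_ ?_ ?_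
  · have h3 := Finset.card_union_le (W ∪ W') P
    have h4 := Finset.card_union_le W W'
    omega
  · exact fun y hy => ⟨w i₁, Finset.mem_insert_of_mem (hW' _ (hw i₁ h₁)), y, by simp, hy⟩
  · exact fun y hy => ⟨w i₂, Finset.mem_insert_of_mem (hW' _ (hw i₂ h₂)), y, by simp, hy⟩
  · intro i hi₁ hi₂
    by_cases hQ'i : i ∈ Q'
    · refine Or.inl ⟨w i, hW' _ (hw i hQ'i), x i, ?_, hx i hQ'i⟩
      exact Finset.mem_union_right _ (Finset.mem_image_of_mem x (by simp [hQ'i, hi₁, hi₂]))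
    by_cases hQi : i ∈ Q
    · obtain ⟨u, hu, v, hv, huv⟩ := hfix i hQi hQ'i
      exact Or.inl ⟨u, hW' _ hu, v, hW' _ hv, huv⟩
    by_cases hi : i ∈ I
    · exact Or.inr fun y _ => ⟨b i, by simp [hbW i hi], z,
        Finset.mem_insert_of_mem (hW' _ hzW), hI i hi z hzZ⟩
    · obtain ⟨u, hu, v, hv, huv⟩ := hcov i hi hQi
      exact Or.inl ⟨u, by simp [hu], v, by simp [hv], huv⟩

/-- Two or more unmatched colors are impossible. -/
theorem false_of_two_unmatched {χ : Finset V → ι} {r : ℕ} (hr : 5 ≤ r)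
    (hι : Fintype.card ι = r - 1) (hV : 200 * r ^ 4 < Fintype.card V) {I Q : Finset ι}
    {b : ι → V} {Z W : Finset V} (hI : ∀ i ∈ I, ∀ x, x ∉ Z → edgesThrough χ r i (b i) x = ∅)
    (hZ : Z.card + Q.card * (60 * r ^ 2) ≤ 60 * r ^ 3) (hbW : ∀ i ∈ I, b i ∈ W)
    (hW : W.card + Q.card + 1 ≤ r)
    (hcov : ∀ i, i ∉ I → i ∉ Q → ∃ u ∈ W, ∃ v ∈ W, v ∈ nbr χ r i u) (hQ2 : 2 ≤ Q.card)
    (hQ : ∀ i ∈ Q, (∃ N, IsSpread χ r i N) ∨ ∃ k A N, IsChvatal χ r i k A N)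
    (hsh : ∀ i ∈ Q, ∀ j ∈ Q, i ≠ j → (sharedPairs χ r i j).card < 2 * r) : False := by
  classical
  have hr3 : 5 * r ^ 3 ≤ r ^ 4 := by
    rw [show r ^ 4 = r * r ^ 3 by ring]
    exact Nat.mul_le_mul_right _ hr
  have hr2 : 5 * r ^ 2 ≤ r ^ 3 := by
    rw [show r ^ 3 = r * r ^ 2 by ring]
    exact Nat.mul_le_mul_right _ hr
  have hr1 : 25 * r ≤ r ^ 3 := by
    rw [show r ^ 3 = r ^ 2 * r by ring]
    exact Nat.mul_le_mul_right _ (Nat.pow_le_pow_left hr 2)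
  have hsh' : ∀ s, ∀ i ∈ Q, ∀ j ∈ Q, i ≠ j → (nbr χ r i s ∩ nbr χ r j s).card < 2 * r :=
    fun s i hi j hj hij => (card_nbr_inter_nbr_le s).trans_lt (hsh i hi j hj hij)
  set Qc := Q.filter fun i => ∃ k A N, IsChvatal χ r i k A N with hQc
  have hQcQ : Qc ⊆ Q := Finset.filter_subset _ _
  have hC : ∀ i ∈ Qc, ∃ k A N, IsChvatal χ r i k A N := fun i hi => (Finset.mem_filter.1 hi).2
  have hS : ∀ i ∈ Q \ Qc, ∃ N, IsSpread χ r i N := by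
    intro i hi
    rw [Finset.mem_sdiff, hQc, Finset.mem_filter] at hi
    exact (hQ i hi.1).resolve_right fun h => hi.2 ⟨hi.1, h⟩
  choose! k A N hC using hC
  choose! M hS using hS
  set E : ι → Finset V := fun i => if i ∈ Qc then N i else M i with hE
  have hEC : ∀ i ∈ Qc, E i = N i := fun i hi => by simp [hE, hi]
  have hES : ∀ i, i ∉ Qc → E i = M i := fun i hi => by simp [hE, hi]
  have hdeg : ∀ i ∈ Q, ∀ v, v ∉ E i → 11 * r ≤ (nbr χ r i v).card := by
    intro i hi v hv
    by_cases hc : i ∈ Qc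
    · exact (hC i hc).le_card_nbr (hEC i hc ▸ hv)
    · exact (hS i (Finset.mem_sdiff.2 ⟨hi, hc⟩)).2 v (hES i hc ▸ hv)
  have hEcard : ∀ i ∈ Q, i ∉ Qc → (E i).card ≤ 60 * r ^ 2 := by
    intro i hi hc
    rw [hES i hc]
    exact (hS i (Finset.mem_sdiff.2 ⟨hi, hc⟩)).1
  -- The set `O` gathers everything that a generic vertex avoids; only the exceptional sets of
  -- Chvátal colors may be large.
  set O := Z ∪ (Q \ Qc).biUnion E with hO
  have hOc : O.card ≤ 60 * r ^ 3 := by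
    have h1 : ((Q \ Qc).biUnion E).card ≤ (Q \ Qc).card * (60 * r ^ 2) :=
      Finset.card_biUnion_le_card_mul _ _ _ fun i hi =>
        hEcard i (Finset.mem_sdiff.1 hi).1 (Finset.mem_sdiff.1 hi).2
    have h2 : (Q \ Qc).card * (60 * r ^ 2) ≤ Q.card * (60 * r ^ 2) :=
      Nat.mul_le_mul_right _ (Finset.card_le_card Finset.sdiff_subset)
    have h3 := Finset.card_union_le Z ((Q \ Qc).biUnion E)
    rw [← hO] at h3
    omega
  have hOE : ∀ x, x ∉ O → x ∉ Z ∧ ∀ i ∈ Q, i ∉ Qc → x ∉ E i := by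
    intro x hx
    rw [hO, Finset.mem_union, not_or] at hx
    refine ⟨hx.1, fun i hi hc hxE => hx.2 (Finset.mem_biUnion.2 ⟨i, ?_, hxE⟩)⟩
    exact Finset.mem_sdiff.2 ⟨hi, hc⟩
  -- a common ordinary vertex of all colors suffices
  have hstar : ∀ s, s ∉ Z → (∀ i ∈ Q, s ∉ E i) → False := by
    intro s hsZ hsE
    refine false_of_fan (W' := {s}) (Q' := Q) hr hι hI hbW hW hcov hQ2 ?_ ?_ ?_ ?_
    · exact fun j hj => ⟨s, by simp, hdeg j hj s (hsE j hj)⟩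
    · exact fun j hj hj' => absurd hj hj'
    · exact ⟨s, by simp, hsZ⟩
    · rw [Finset.card_singleton]; omega
  rcases Finset.eq_empty_or_nonempty Qc with hempty | hne
  · obtain ⟨s, -, hs⟩ := Finset.exists_mem_notMem_of_card_lt_card (s := O)
      (t := (Finset.univ : Finset V)) (by rw [Finset.card_univ]; omega)
    exact hstar s (hOE s hs).1 fun i hi => (hOE s hs).2 i hi (by simp [hempty])
  rcases Nat.lt_or_ge Q.card 3 with hQ3 | hQ3
  · obtain ⟨i, j, hij, hQij⟩ := Finset.card_eq_two.1 (show Q.card = 2 by omega)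
    have hi : i ∈ Q := by simp [hQij]
    have hj : j ∈ Q := by simp [hQij]
    by_cases hs : ∃ s, s ∉ (E i ∪ E j) ∪ Z
    · obtain ⟨s, hs⟩ := hs
      simp only [Finset.mem_union, not_or] at hs
      refine hstar s hs.2 ?_
      rw [hQij]
      simpa using hs.1
    · push Not at hs
      have hcard := Finset.card_le_card (fun s (_ : s ∈ (Finset.univ : Finset V)) => hs s)
      have h1 := Finset.card_union_le (E i ∪ E j) Z
      have h2 := Finset.card_union_le (E i) (E j)
      rw [Finset.card_univ] at hcard
      have hE2 : ∀ l ∈ Q, 2 * (E l).card < Fintype.card V := by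
        intro l hl
        by_cases hc : l ∈ Qc
        · have h3 := (hC l hc).card_le
          have h4 := (hC l hc).two_mul_lt
          rw [hEC l hc]; omega
        · have := hEcard l hl hc
          omega
      have hiE := hE2 i hi
      have hjE := hE2 j hj
      have hci : i ∈ Qc := by
        by_contra hc
        have := hEcard i hi hc
        omega
      have hcj : j ∈ Qc := by
        by_contra hc
        have := hEcard j hj hc
        omega
      have hNi := (hC i hci).card_le
      have hNj := (hC j hcj).card_le
      rw [← hEC i hci] at hNi
      rw [← hEC j hcj] at hNj
      obtain ⟨s, -, hs⟩ := Finset.exists_mem_notMem_of_card_lt_card (s := E i ∪ E j)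
        (t := (Finset.univ : Finset V)) (by rw [Finset.card_univ]; omega)
      rw [Finset.mem_union, not_or] at hs
      have hsi := (hC i hci).le_nbr_of_notMem s (hEC i hci ▸ hs.1)
      refine false_of_two_free_of_le (χ := χ) hr hι (W := insert s W) (X := nbr χ r i s \ Z)
        (Y := nbr χ r j s) ?_ ?_ (hdeg j hj s hs.2) i j ?_ ?_ ?_
      · have := Finset.card_insert_le s W
        omega
      · have := Finset.le_card_sdiff Z (nbr χ r i s)
        omega
      · exact fun x hx => ⟨s, by simp, x, by simp, (Finset.mem_sdiff.1 hx).1⟩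
      · exact fun x hx => ⟨s, by simp, x, by simp, hx⟩
      · intro l hli hlj
        have hlQ : l ∉ Q := by simp [hQij, hli, hlj]
        by_cases hl : l ∈ I
        · exact Or.inr fun x hx => ⟨b l, by simp [hbW l hl], x, by simp,
            hI l hl x (Finset.mem_sdiff.1 hx).2⟩
        · obtain ⟨u, hu, v, hv, huv⟩ := hcov l hl hlQ
          exact Or.inl ⟨u, by simp [hu], v, by simp [hv], huv⟩
  · obtain ⟨i, hi, s, x, hx, hxO, hsx⟩ := exists_center hr hV hne
      (lt_of_le_of_lt (Finset.card_le_card hQcQ) (by omega)) hC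
      (fun s i hi j hj => hsh' s i (hQcQ hi) j (hQcQ hj)) hOc
    have hiQ := hQcQ hi
    -- The pair itself settles color `i`. The second center is thus paid for, and at least two
    -- colors remain for the open leaves.
    refine false_of_fan (W' := {s, x}) (Q' := Q.erase i) hr hι hI hbW hW hcov ?_ ?_ ?_ ?_ ?_
    · rw [Finset.card_erase_of_mem hiQ]; omega
    · intro j hj
      rw [Finset.mem_erase] at hj
      by_cases hc : j ∈ Qc
      · rcases hsx j hc hj.1 with h | h
        · exact ⟨s, by simp, (hC j hc).le_card_nbr h⟩
        · exact ⟨x, by simp, (hC j hc).le_card_nbr h⟩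
      · exact ⟨x, by simp, hdeg j hj.2 x ((hOE x hxO).2 j hj.2 hc)⟩
    · intro j hj hj'
      have : j = i := by
        by_contra h
        exact hj' (Finset.mem_erase.2 ⟨h, hj⟩)
      subst this
      exact ⟨s, by simp, x, by simp, hx⟩
    · exact ⟨x, by simp, (hOE x hxO).1⟩
    · have h1 := Finset.card_erase_of_mem hiQ
      have h2 := Finset.card_le_two (a := s) (b := x)
      omega

/-- The budget is `I.card + J.card = r - 1`: void colors cost one vertex each and matched colors one
vertex each on average. The cases differ in whether two non-void colors share many sparse pairs and
in how many colors stay unmatched. -/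
theorem exists_hasHamBerge {r : ℕ} (hr : 5 ≤ r) (hι : Fintype.card ι = r - 1)
    (hV : 200 * r ^ 4 < Fintype.card V) (χ : Finset V → ι) : ∃ i, HasHamBerge χ r i := by
  classical
  by_contra hcon
  push Not at hcon
  have hr3 : 5 * r ^ 3 ≤ r ^ 4 := by
    rw [show r ^ 4 = r * r ^ 3 by ring]
    exact Nat.mul_le_mul_right _ hr
  have hr2 : 5 * r ^ 2 ≤ r ^ 3 := by
    rw [show r ^ 3 = r * r ^ 2 by ring]
    exact Nat.mul_le_mul_right _ hr
  have hr1 : 5 * r ≤ r ^ 2 := by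
    rw [show r ^ 2 = r * r by ring]
    exact Nat.mul_le_mul_right _ hr
  have : Nonempty V := Fintype.card_pos_iff.1 (by omega)
  have htri := fun i => color_trichotomy hr hV (hcon i)
  set I : Finset ι := Finset.univ.filter fun i => ∃ b Z, IsVoid χ r i b Z with hIdef
  have hvoid : ∀ i ∈ I, ∃ b Z, IsVoid χ r i b Z := by
    intro i hi
    simpa [hIdef] using hi
  have hrest : ∀ i, i ∉ I → (∃ N, IsSpread χ r i N) ∨ ∃ k A N, IsChvatal χ r i k A N := by
    intro i hi
    rcases htri i with h | h
    · exact absurd (by simpa [hIdef] using h) hi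
    · exact h
  choose! b Zs hvoid using hvoid
  set Z := I.biUnion Zs with hZdef
  have hI : ∀ i ∈ I, ∀ x, x ∉ Z → edgesThrough χ r i (b i) x = ∅ := fun i hi x hx =>
    (hvoid i hi).2.2 x fun h => hx (Finset.mem_biUnion.2 ⟨i, hi, h⟩)
  have hZ : Z.card ≤ I.card * (60 * r ^ 2) :=
    Finset.card_biUnion_le_card_mul _ _ _ fun i hi => (hvoid i hi).2.1
  set S := I.image b with hSdef
  have hbS : ∀ i ∈ I, b i ∈ S := fun i hi => Finset.mem_image_of_mem b hi
  have hSc : S.card ≤ I.card := Finset.card_image_le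
  set J := Iᶜ with hJdef
  have hJI : ∀ i, i ∈ J ↔ i ∉ I := fun i => Finset.mem_compl
  have hIJ : I.card + J.card = r - 1 := by rw [hJdef, Finset.card_add_card_compl, hι]
  have hZQ : ∀ q, I.card + q ≤ r → Z.card + q * (60 * r ^ 2) ≤ 60 * r ^ 3 := by
    intro q hq
    have h1 := Nat.mul_le_mul_right (60 * r ^ 2) hq
    have h2 : r * (60 * r ^ 2) = 60 * r ^ 3 := by ring
    rw [add_mul] at h1
    omega
  have hZ0 : Z.card ≤ 60 * r ^ 3 := by
    have := hZQ 0 (by omega)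
    omega
  by_cases hshare : ∃ i₁ ∈ J, ∃ i₂ ∈ J, i₁ ≠ i₂ ∧ 2 * r ≤ (sharedPairs χ r i₁ i₂).card
  · obtain ⟨i₁, h₁, i₂, h₂, h₁₂, hs⟩ := hshare
    have h₂' : i₂ ∈ J.erase i₁ := Finset.mem_erase.2 ⟨h₁₂.symm, h₂⟩
    have hc1 := Finset.card_erase_of_mem h₁
    have hc2 := Finset.card_erase_of_mem h₂'
    have hpos : 0 < (J.erase i₁).card := Finset.card_pos.2 ⟨i₂, h₂'⟩
    obtain ⟨Q, U, hQJ, hUQ, hcovU, hsh⟩ :=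
      exists_matching (χ := χ) (r := r) (by omega) ((J.erase i₁).erase i₂)
    obtain ⟨g, hg⟩ : (sharedPairs χ r i₁ i₂).Nonempty := Finset.card_pos.1 (by omega)
    obtain ⟨u, v, -, hu, hv⟩ := (Finset.mem_filter.1 hg).2
    have hQJ' : ∀ i ∈ Q, i ∉ I := by
      intro i hi
      have := hQJ hi
      simp only [Finset.mem_erase] at this
      exact (hJI i).1 this.2.2
    have hSU := Finset.card_union_le S U
    set W := (S ∪ U) ∪ {u, v} with hWdef
    have hWc : W.card + Q.card + 1 ≤ r := by
      have h3 := Finset.card_union_le (S ∪ U) {u, v}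
      rw [← hWdef] at h3
      have h4 := Finset.card_le_two (a := u) (b := v)
      omega
    have hcov : ∀ i, i ∉ I → i ∉ Q → ∃ u ∈ W, ∃ v ∈ W, v ∈ nbr χ r i u := by
      intro i hi hiQ
      by_cases hi₁ : i = i₁
      · exact ⟨u, by simp [hWdef], v, by simp [hWdef], hi₁ ▸ hu⟩
      by_cases hi₂ : i = i₂
      · exact ⟨u, by simp [hWdef], v, by simp [hWdef], hi₂ ▸ hv⟩
      obtain ⟨x, hx, y, hy, hxy⟩ := hcovU i (by simp [hi₁, hi₂, hJI, hi]) hiQ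
      exact ⟨x, by simp [hWdef, hx], y, by simp [hWdef, hy], hxy⟩
    have hbW : ∀ i ∈ I, b i ∈ W := fun i hi => by simp [hWdef, hbS i hi]
    rcases Nat.lt_or_ge 1 Q.card with hQ1 | hQ1
    · exact false_of_two_unmatched hr hι hV hI (hZQ _ (by omega)) hbW hWc hcov hQ1
        (fun i hi => hrest i (hQJ' i hi)) hsh
    · rcases Finset.eq_empty_or_nonempty Q with hQ0 | ⟨i₃, h₃⟩
      · refine false_of_one_free hr hι (χ := χ) (W := W) (Z := Z) (by omega) (by omega) fun i => ?_
        by_cases hi : i ∈ I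
        · exact Or.inr fun x hx => ⟨b i, hbW i hi, hI i hi x hx⟩
        · exact Or.inl (hcov i hi (by simp [hQ0]))
      · have hQ3 : ∀ i, i ∈ Q → i = i₃ := fun i hi => Finset.card_le_one.1 hQ1 i hi i₃ h₃
        have hQc : 0 < Q.card := Finset.card_pos.2 ⟨i₃, h₃⟩
        obtain ⟨N, hN, hN'⟩ : ∃ N : Finset V, 2 * N.card < Fintype.card V ∧
            ∀ v, v ∉ N → 11 * r ≤ (nbr χ r i₃ v).card := by
          rcases hrest i₃ (hQJ' i₃ h₃) with ⟨N, hN⟩ | ⟨k, A, N, hN⟩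
          · exact ⟨N, by have := hN.1; omega, hN.2⟩
          · refine ⟨N, ?_, fun v hv => hN.le_card_nbr hv⟩
            have h3 := hN.card_le
            have h4 := hN.two_mul_lt
            omega
        refine false_of_one_unmatched hr hι hV hI hZ0 (W := S ∪ U) (i₁ := i₁) (i₂ := i₂)
          (i₃ := i₃) (fun i hi => by simp [hbS i hi]) (by omega) hs ?_ hN hN'
        intro i hi hi₁ hi₂ hi₃
        obtain ⟨x, hx, y, hy, hxy⟩ := hcovU i (by simp [hi₁, hi₂, hJI, hi]) fun h => hi₃ (hQ3 i h)
        exact ⟨x, by simp [hx], y, by simp [hy], hxy⟩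
  · push Not at hshare
    have hcov : ∀ i, i ∉ I → i ∉ J → ∃ u ∈ S, ∃ v ∈ S, v ∈ nbr χ r i u :=
      fun i hi hj => absurd ((hJI i).2 hi) hj
    rcases Nat.lt_or_ge 1 J.card with hJ1 | hJ1
    · exact false_of_two_unmatched hr hι hV hI (hZQ _ (by omega)) hbS (by omega) hcov hJ1
        (fun i hi => hrest i ((hJI i).1 hi)) hshare
    · rcases Finset.eq_empty_or_nonempty J with hJ0 | ⟨i, hi⟩
      · refine false_of_one_free hr hι (χ := χ) (W := S) (Z := Z) (by omega) (by omega) fun i => ?_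
        have hi : i ∈ I := by
          by_contra h
          have := (hJI i).2 h
          simp [hJ0] at this
        exact Or.inr fun x hx => ⟨b i, hbS i hi, hI i hi x hx⟩
      · have hJ3 : ∀ j, j ∈ J → j = i := fun j hj => Finset.card_le_one.1 hJ1 j hj i hi
        have hJc : 0 < J.card := Finset.card_pos.2 ⟨i, hi⟩
        obtain ⟨S', hSS', hS'⟩ := Finset.exists_superset_card_eq (s := S) (n := r - 2)
          (by omega) (by omega)
        -- Only `i` is not void. A set of `r - 2` vertices contains all the void vertices, so an
        -- edge through it and a vertex outside `Z` must have color `i`.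
        refine hcon i (hasHamBerge_of_sunflower hr (S := S') (Z := Z) (by omega) (by omega) ?_)
        intro x y hx hy hxy hyZ
        by_contra hne
        have hj : χ (insert x (insert y S')) ∈ I := by
          by_contra h
          exact hne (hJ3 _ ((hJI _).2 h))
        have hmem : insert x (insert y S') ∈ edgesThrough χ r (χ (insert x (insert y S')))
            (b (χ (insert x (insert y S')))) y := by
          refine mem_edgesThrough.2 ⟨?_, rfl, ?_, by simp⟩
          · rw [Finset.card_insert_of_notMem, Finset.card_insert_of_notMem hy]
            · omega
            · simp [hxy, hx]
          · simp [hSS' (hbS _ hj)]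
        rw [hI _ hj y hyZ] at hmem
        simp at hmem

/-- Since `4 ≤ r - 1 ≤ 4 * r / 2`, the binomial coefficient is at least `Nat.choose (4 * r) 4`,
which is of order `r ^ 4`; only this polynomial consequence is needed. -/
theorem two_hundred_mul_pow_lt {r n : ℕ} (hr : 5 ≤ r)
    (hn : 6 * r * Nat.choose (4 * r) (r - 1) < n) : 200 * r ^ 4 < n := by
  have hmono : Nat.choose (4 * r) 4 ≤ Nat.choose (4 * r) (r - 1) := by
    have : ∀ m, 4 ≤ m → m ≤ r - 1 → Nat.choose (4 * r) 4 ≤ Nat.choose (4 * r) m := by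
      intro m hm
      induction m, hm using Nat.le_induction with
      | base => exact fun _ => le_rfl
      | succ m hm ih =>
        intro hmr
        exact (ih (by omega)).trans (Nat.choose_le_succ_of_lt_half_left (by omega))
    exact this _ (by omega) le_rfl
  have hfac : Nat.choose (4 * r) 4 * 24 = (4 * r) * (4 * r - 1) * (4 * r - 2) * (4 * r - 3) := by
    have h := Nat.descFactorial_eq_factorial_mul_choose (4 * r) 4
    simp only [Nat.descFactorial, Nat.factorial] at h
    norm_num at h
    rw [mul_comm, ← h]
    ring
  obtain ⟨m, rfl⟩ : ∃ m, r = m + 5 := ⟨r - 5, by omega⟩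
  rw [show 4 * (m + 5) - 1 = 4 * m + 19 by omega, show 4 * (m + 5) - 2 = 4 * m + 18 by omega,
    show 4 * (m + 5) - 3 = 4 * m + 17 by omega] at hfac
  have h1 : 6 * (m + 5) * Nat.choose (4 * (m + 5)) 4 ≤
      6 * (m + 5) * Nat.choose (4 * (m + 5)) (m + 5 - 1) := Nat.mul_le_mul_left _ hmono
  have h2 : 200 * (m + 5) ^ 4 ≤ 6 * (m + 5) * Nat.choose (4 * (m + 5)) 4 := by
    have h3 : 4 * (6 * (m + 5) * Nat.choose (4 * (m + 5)) 4) =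
        (m + 5) * (4 * (m + 5) * (4 * m + 19) * (4 * m + 18) * (4 * m + 17)) := by
      rw [← hfac]; ring
    have h4 : 4 * (200 * (m + 5) ^ 4) ≤
        (m + 5) * (4 * (m + 5) * (4 * m + 19) * (4 * m + 18) * (4 * m + 17)) := by
      have h5 : 200 * (m + 5) ^ 2 ≤ (4 * m + 19) * (4 * m + 18) * (4 * m + 17) := by
        ring_nf; nlinarith [sq_nonneg m, pow_nonneg (Nat.zero_le m) 3]
      calc 4 * (200 * (m + 5) ^ 4) = 4 * (m + 5) ^ 2 * (200 * (m + 5) ^ 2) := by ring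
        _ ≤ 4 * (m + 5) ^ 2 * ((4 * m + 19) * (4 * m + 18) * (4 * m + 17)) :=
          Nat.mul_le_mul_left _ h5
        _ = _ := by ring
    omega
  omega

open Classical in
/-- The extension of an edge coloring to all finite sets. -/
noncomputable def extendColoring {V K : Type*} [Inhabited K] {r : ℕ}
    (c : EdgeColoring (completeUniform V r) K) (e : Finset V) : K :=
  -- The default value is immaterial, as `edgesThrough` only sees sets of size `r`.
  if h : (e : Set V) ∈ (completeUniform V r).edgeSet then c ⟨e, h⟩ else default

theorem hasBergeCycle_of_hasHamBerge {K : Type*} [Inhabited K] [DecidableEq K] {r : ℕ}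
    (c : EdgeColoring (completeUniform V r) K) {i : K} (h : HasHamBerge (extendColoring c) r i) :
    HasBergeCycle (colorClass c i) (Fintype.card V) := by
  obtain ⟨v, e, hv, he, hve⟩ := h
  refine ⟨v, fun j => (e j : Set V), hv, fun a b hab => he (Finset.coe_injective hab), ?_, ?_, ?_⟩
  · intro j
    obtain ⟨h1, h2, -⟩ := mem_edgesThrough.1 (hve j)
    have hmem : (e j : Set V) ∈ (completeUniform V r).edgeSet := by
      change (e j : Set V).encard = r
      rw [Set.encard_coe_eq_coe_finsetCard, h1]
    refine ⟨hmem, ?_⟩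
    rw [extendColoring, dif_pos hmem] at h2
    exact h2
  · exact fun j => (mem_edgesThrough.1 (hve j)).2.2.1
  · exact fun j => (mem_edgesThrough.1 (hve j)).2.2.2

end Main

theorem theorem1p1 (r n : ℕ) (hr : 5 ≤ r) (hn : 6 * r * Nat.choose (4 * r) (r - 1) < n) :
    (∀ c : EdgeColoring (completeUniform (Fin n) r) (Fin (r - 1)),
      ∃ i : Fin (r - 1), HasHamiltonianBergeCycle (colorClass c i)) ∧
    IsBergeCycleRamseyNumber (r - 1) r n n := by
  have : Inhabited (Fin (r - 1)) := ⟨⟨0, by omega⟩⟩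
  have key : ∀ c : EdgeColoring (completeUniform (Fin n) r) (Fin (r - 1)),
      ∃ i : Fin (r - 1), HasBergeCycle (colorClass c i) n := by
    intro c
    obtain ⟨i, hi⟩ := exists_hasHamBerge hr (Fintype.card_fin _)
      (by rw [Fintype.card_fin]; exact two_hundred_mul_pow_lt hr hn) (extendColoring c)
    refine ⟨i, ?_⟩
    have h := hasBergeCycle_of_hasHamBerge c hi
    rwa [Fintype.card_fin] at h
  refine ⟨?_, key, ?_⟩
  · intro c
    obtain ⟨i, hi⟩ := key c
    refine ⟨i, ?_⟩
    have h : (colorClass c i).vertexSet.ncard = n := by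
      change (Set.univ : Set (Fin n)).ncard = n
      rw [Set.ncard_univ, Nat.card_fin]
    rw [HasHamiltonianBergeCycle, h]
    exact hi
  -- Minimality: a Berge-cycle of length `n` has `n` distinct core vertices, so any coloring, such
  -- as a constant one, shows `n ≤ m`.
  · intro m hm
    obtain ⟨i, v, e, h⟩ := hm fun _ => default
    simpa using Fintype.card_le_of_injective v h.core_injective
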